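/- Graphs are finite, without loops, possibly with multiple edges and possibly with no nodes. A \emph{graph parameter} is a real-valued function $f$ on graphs that is invariant under isomorphism; it is \emph{multiplicative} if $f(F_1F_2)=f(F_1)f(F_2)$ for all graphs $F_1,F_2$, where $F_1F_2$ is the disjoint union. A \emph{finite weighted graph} $H$ has a finite (possibly empty) node set $V(H)$, positive real nodeweights $\alpha_H(i)$ and symmetric real edgeweights $\beta_H(i,j)$ (loops are allowed; $\beta_H(i,j)=0$ if $i,j$ are not adjacent). For a graph $F$, $$\hom(F,H)=\sum_{\psi:V(F)\to V(H)}\ \prod_{i\in V(F)}\alpha_H(\psi(i))\prod_{uv\in E(F)}\beta_H(\psi(u),\psi(v)),$$ where edges are counted with multiplicity. For $k\ge 0$, a \emph{$k$-labeled graph} is a graph in which $k$ distinct nodes are labeled $1,\dots,k$. The product of two $k$-labeled graphs is their disjoint union with nodes of equal label identified (multiplicities of edges are added). Let $\mathcal G_k$ be the commutative algebra of formal finite real linear combinations of $k$-labeled graphs (up to label-preserving isomorphism) with the bilinear extension of this product, and extend $f$ linearly to $\mathcal G_k$, ignoring the labels. Call $f$ \emph{reflection positive} if $f(x^2)\ge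 0$ for all $k\ge 0$ and all $x\in\mathcal G_k$. Let $\mathcal G_2^0\subseteq\mathcal G_2$ be the subalgebra spanned by the $2$-labeled graphs whose labeled nodes are nonadjacent, and let $x\mapsto x'$, $\mathcal G_2^0\to\mathcal G_1$, be the linear extension of the map that identifies the two labeled nodes. An element $z\in\mathcal G_2$ is a \emph{contractor} for $f$ if $f(xz)=f(x')$ for every $x\in\mathcal G_2^0$. \textbf{Theorem.} Let $f$ be a graph parameter. There is a finite weighted graph $H$ with $f(F)=\hom(F,H)$ for every graph $F$ if and only if $f$ is not identically zero, is multiplicative, is reflection positive, and has a contractor. -/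

import Mathlib

namespace GraphAlg

/-- A finite graph: multiple edges are allowed, loops are not.  The edges form a finite
multiset of unordered pairs of distinct nodes.  There may be no nodes at all. -/
structure FinGraph : Type 1 where
  V : Type
  [fintypeV : Fintype V]
  edges : Multiset (Sym2 V)
  loopless : ∀ e ∈ edges, ¬ e.IsDiag

attribute [instance] FinGraph.fintypeV

namespace FinGraph

/-- Two graphs are isomorphic if some bijection of the nodes carries one edge multiset
(with multiplicities) to the other. -/
def Iso (G H : FinGraph) : Prop :=
  ∃ φ : G.V ≃ H.V, G.edges.map (Sym2.map φ) = H.edges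

/-- The disjoint union of two graphs. -/
def disjUnion (G H : FinGraph) : FinGraph where
  V := G.V ⊕ H.V
  edges := G.edges.map (Sym2.map Sum.inl) + H.edges.map (Sym2.map Sum.inr)
  loopless := by
    intro e he
    rw [Multiset.mem_add, Multiset.mem_map, Multiset.mem_map] at he
    rcases he with ⟨d, hd, rfl⟩ | ⟨d, hd, rfl⟩
    · rw [Sym2.isDiag_map Sum.inl_injective]; exact G.loopless d hd
    · rw [Sym2.isDiag_map Sum.inr_injective]; exact H.loopless d hd

end FinGraph

/-- A graph parameter: a real function on graphs, invariant under isomorphism. -/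
structure GraphParameter : Type 1 where
  toFun : FinGraph → ℝ
  iso_inv : ∀ G H : FinGraph, G.Iso H → toFun G = toFun H

instance : CoeFun GraphParameter (fun _ => FinGraph → ℝ) := ⟨GraphParameter.toFun⟩

/-- `f(F₁F₂) = f(F₁) f(F₂)`, where `F₁F₂` is the disjoint union. -/
def GraphParameter.Multiplicative (f : GraphParameter) : Prop :=
  ∀ F₁ F₂ : FinGraph, f (F₁.disjUnion F₂) = f F₁ * f F₂

/-! ### Weighted graphs and homomorphism functions -/

/-- A finite weighted graph: positive nodeweights and real (possibly negative) edgeweights.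
Loops are allowed, and a pair that is not an edge has edgeweight `0`. -/
structure WeightedGraph : Type 1 where
  V : Type
  [fintypeV : Fintype V]
  α : V → ℝ
  α_pos : ∀ i, 0 < α i
  β : V → V → ℝ
  β_symm : ∀ i j, β i j = β j i

attribute [instance] WeightedGraph.fintypeV

/-- The weight of an unordered pair of nodes. -/
def WeightedGraph.edgeWeight (H : WeightedGraph) : Sym2 H.V → ℝ :=
  Sym2.lift ⟨H.β, H.β_symm⟩

open scoped Classical in
/-- `hom(F,H) = ∑_ψ ∏_{i ∈ V(F)} α(ψ i) ∏_{uv ∈ E(F)} β(ψ u, ψ v)`, the sum over all maps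
`ψ : V(F) → V(H)` and the last product over all edges with their multiplicities. -/
noncomputable def WeightedGraph.hom (H : WeightedGraph) (F : FinGraph) : ℝ :=
  ∑ ψ : F.V → H.V, (∏ i, H.α (ψ i)) * (F.edges.map fun e => H.edgeWeight (e.map ψ)).prod

/-! ### Labeled graphs -/

/-- A `k`-labeled graph: a finite loopless multigraph with `k` distinct nodes labeled by the
elements of `Fin k` and a finite set `U` of unlabeled nodes.  The node set is taken to be
`Fin k ⊕ U`, so that the node with label `i` is `Sum.inl i`. -/
structure LabeledGraph (k : ℕ) : Type 1 where
  U : Type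
  [fintypeU : Fintype U]
  edges : Multiset (Sym2 (Fin k ⊕ U))
  loopless : ∀ e ∈ edges, ¬ e.IsDiag

attribute [instance] LabeledGraph.fintypeU

namespace LabeledGraph

variable {k : ℕ}

theorem map_map_edges {A B C : Type} (g : A → B) (h : B → C) (s : Multiset (Sym2 A)) :
    (s.map (Sym2.map g)).map (Sym2.map h) = s.map (Sym2.map (h ∘ g)) := by
  rw [Multiset.map_map, Sym2.map_comp]

theorem map_edges_congr {A B : Type} {g h : A → B} (hgh : ∀ a, g a = h a)
    (s : Multiset (Sym2 A)) : s.map (Sym2.map g) = s.map (Sym2.map h) := by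
  rw [funext hgh]

theorem map_edges_id {A : Type} {g : A → A} (hg : ∀ a, g a = a) (s : Multiset (Sym2 A)) :
    s.map (Sym2.map g) = s := by
  rw [show g = id from funext hg, Sym2.map_id, Multiset.map_id]

/-- Forget the labels. -/
def toFinGraph (F : LabeledGraph k) : FinGraph where
  V := Fin k ⊕ F.U
  edges := F.edges
  loopless := F.loopless

/-- Label-preserving isomorphism. -/
def Iso (F G : LabeledGraph k) : Prop :=
  ∃ φ : F.U ≃ G.U, F.edges.map (Sym2.map (Sum.map id φ)) = G.edges

theorem Iso.refl (F : LabeledGraph k) : F.Iso F := ⟨Equiv.refl _, by simp⟩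

theorem Iso.symm {F G : LabeledGraph k} (h : F.Iso G) : G.Iso F := by
  obtain ⟨φ, h⟩ := h
  refine ⟨φ.symm, ?_⟩
  rw [← h, map_map_edges]
  exact map_edges_id (by rintro (i | u) <;> simp) _

theorem Iso.trans {F G H : LabeledGraph k} (h : F.Iso G) (h' : G.Iso H) : F.Iso H := by
  obtain ⟨φ, h⟩ := h
  obtain ⟨ψ, h'⟩ := h'
  refine ⟨φ.trans ψ, ?_⟩
  rw [← h', ← h, map_map_edges]
  exact map_edges_congr (by rintro (i | u) <;> simp) _

theorem Iso.toFinGraph {F G : LabeledGraph k} (h : F.Iso G) :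
    F.toFinGraph.Iso G.toFinGraph := by
  obtain ⟨φ, h⟩ := h
  exact ⟨Equiv.sumCongr (Equiv.refl _) φ, h⟩

instance setoid (k : ℕ) : Setoid (LabeledGraph k) :=
  ⟨Iso, ⟨Iso.refl, Iso.symm, Iso.trans⟩⟩

/-- The product of two `k`-labeled graphs: their disjoint union, with nodes of the same label
identified.  Multiplicities of edges between labeled nodes add up. -/
def glue (F G : LabeledGraph k) : LabeledGraph k where
  U := F.U ⊕ G.U
  edges := F.edges.map (Sym2.map (Sum.map id Sum.inl)) +
    G.edges.map (Sym2.map (Sum.map id Sum.inr))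
  loopless := by
    intro e he
    rw [Multiset.mem_add, Multiset.mem_map, Multiset.mem_map] at he
    rcases he with ⟨d, hd, rfl⟩ | ⟨d, hd, rfl⟩
    · rw [Sym2.isDiag_map (Function.injective_id.sumMap Sum.inl_injective)]
      exact F.loopless d hd
    · rw [Sym2.isDiag_map (Function.injective_id.sumMap Sum.inr_injective)]
      exact G.loopless d hd

/-- The graph `O_k` with `k` labeled nodes, no other nodes and no edges. -/
def edgeless (k : ℕ) : LabeledGraph k where
  U := Empty
  edges := 0
  loopless := by simp

/-- The labeled nodes are pairwise nonadjacent. -/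
def LabelsIndep (F : LabeledGraph k) : Prop :=
  ∀ i j : Fin k, s(Sum.inl i, Sum.inl j) ∉ F.edges

/-- The map that identifies the two labeled nodes. -/
def mergeNodes (U : Type) : Fin 2 ⊕ U → Fin 1 ⊕ U :=
  Sum.map (fun _ => 0) id

/-- For a `2`-labeled graph `F` with nonadjacent labeled nodes, the `1`-labeled graph `F'`
obtained by identifying the two labeled nodes. -/
def contract (F : LabeledGraph 2) (h : F.LabelsIndep) : LabeledGraph 1 where
  U := F.U
  edges := F.edges.map (Sym2.map (mergeNodes F.U))
  loopless := by
    intro e he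
    rw [Multiset.mem_map] at he
    obtain ⟨d, hd, rfl⟩ := he
    induction d using Sym2.ind with
    | _ a b =>
      have hab := F.loopless _ hd
      rw [Sym2.mk_isDiag_iff] at hab
      rw [Sym2.map_mk, Sym2.mk_isDiag_iff]
      rcases a with i | u <;> rcases b with j | v
      · exact absurd hd (h i j)
      · simp [mergeNodes]
      · simp [mergeNodes]
      · intro hc
        apply hab
        simpa [mergeNodes] using hc

theorem Iso.glue {F F' G G' : LabeledGraph k} (h : F.Iso F') (h' : G.Iso G') :
    (F.glue G).Iso (F'.glue G') := by
  obtain ⟨φ, h⟩ := h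
  obtain ⟨ψ, h'⟩ := h'
  refine ⟨Equiv.sumCongr φ ψ, ?_⟩
  simp only [LabeledGraph.glue, ← h, ← h', Multiset.map_add, map_map_edges]
  exact congrArg₂ _ (map_edges_congr (by rintro (i | u) <;> rfl) _)
    (map_edges_congr (by rintro (i | u) <;> rfl) _)

theorem glue_assoc (F G H : LabeledGraph k) :
    ((F.glue G).glue H).Iso (F.glue (G.glue H)) := by
  refine ⟨Equiv.sumAssoc _ _ _, ?_⟩
  simp only [LabeledGraph.glue, Multiset.map_add, map_map_edges, add_assoc]
  exact congrArg₂ _ (map_edges_congr (by rintro (i | u) <;> rfl) _)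
    (congrArg₂ _ (map_edges_congr (by rintro (i | u) <;> rfl) _)
      (map_edges_congr (by rintro (i | u) <;> rfl) _))

theorem glue_comm (F G : LabeledGraph k) : (F.glue G).Iso (G.glue F) := by
  refine ⟨Equiv.sumComm _ _, ?_⟩
  simp only [LabeledGraph.glue, Multiset.map_add, map_map_edges]
  rw [add_comm]
  exact congrArg₂ _ (map_edges_congr (by rintro (i | u) <;> rfl) _)
    (map_edges_congr (by rintro (i | u) <;> rfl) _)

theorem edgeless_glue (F : LabeledGraph k) : ((edgeless k).glue F).Iso F := by
  refine ⟨Equiv.emptySum Empty _, ?_⟩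
  simp only [LabeledGraph.glue, edgeless, Multiset.map_zero, zero_add, map_map_edges]
  exact map_edges_id (by rintro (i | u) <;> rfl) _

theorem LabelsIndep.of_iso {F G : LabeledGraph k} (h : F.Iso G) (hF : F.LabelsIndep) :
    G.LabelsIndep := by
  obtain ⟨φ, h⟩ := h
  intro i j hij
  rw [← h, Multiset.mem_map] at hij
  obtain ⟨d, hd, hdij⟩ := hij
  have hinj : Function.Injective (Sum.map (id : Fin k → Fin k) φ) :=
    Function.injective_id.sumMap φ.injective
  have : d = s(Sum.inl i, Sum.inl j) := by
    apply Sym2.map.injective hinj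
    rw [hdij]; rfl
  exact hF i j (this ▸ hd)

theorem LabelsIndep.glue {F G : LabeledGraph k} (hF : F.LabelsIndep) (hG : G.LabelsIndep) :
    (F.glue G).LabelsIndep := by
  intro i j hij
  rcases Multiset.mem_add.1 hij with hij | hij
  · obtain ⟨d, hd, hdij⟩ := Multiset.mem_map.1 hij
    have : d = s(Sum.inl i, Sum.inl j) := by
      apply Sym2.map.injective (Function.injective_id.sumMap (Sum.inl_injective (β := G.U)))
      rw [hdij]; rfl
    exact hF i j (this ▸ hd)
  · obtain ⟨d, hd, hdij⟩ := Multiset.mem_map.1 hij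
    have : d = s(Sum.inl i, Sum.inl j) := by
      apply Sym2.map.injective (Function.injective_id.sumMap (Sum.inr_injective (α := F.U)))
      rw [hdij]; rfl
    exact hG i j (this ▸ hd)

theorem labelsIndep_edgeless : (edgeless k).LabelsIndep := by
  intro i j
  exact Multiset.notMem_zero _

theorem Iso.contract {F G : LabeledGraph 2} (h : F.Iso G) (hF : F.LabelsIndep)
    (hG : G.LabelsIndep) : (F.contract hF).Iso (G.contract hG) := by
  obtain ⟨φ, h⟩ := h
  refine ⟨φ, ?_⟩
  simp only [LabeledGraph.contract, mergeNodes, ← h, map_map_edges]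
  exact map_edges_congr (by rintro (i | u) <;> rfl) _

end LabeledGraph

/-! ### Isomorphism classes and the graph algebras -/

/-- `k`-labeled graphs up to label-preserving isomorphism. -/
def LabeledClass (k : ℕ) : Type 1 := Quotient (LabeledGraph.setoid k)

namespace LabeledClass

variable {k : ℕ}

/-- The isomorphism class of a `k`-labeled graph. -/
def mk (F : LabeledGraph k) : LabeledClass k := Quotient.mk _ F

/-- Gluing along the labeled nodes makes the isomorphism classes a commutative monoid with
unit `O_k`. -/
instance : CommMonoid (LabeledClass k) where
  mul := Quotient.map₂ LabeledGraph.glue fun _ _ h _ _ h' => h.glue h'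
  one := mk (LabeledGraph.edgeless k)
  mul_assoc := by
    rintro ⟨F⟩ ⟨G⟩ ⟨H⟩
    exact Quotient.sound (LabeledGraph.glue_assoc F G H)
  mul_comm := by
    rintro ⟨F⟩ ⟨G⟩
    exact Quotient.sound (LabeledGraph.glue_comm F G)
  one_mul := by
    rintro ⟨F⟩
    exact Quotient.sound (LabeledGraph.edgeless_glue F)
  mul_one := by
    rintro ⟨F⟩
    exact Quotient.sound ((LabeledGraph.glue_comm _ _).trans (LabeledGraph.edgeless_glue F))

/-- The value of a graph parameter on a class of labeled graphs; the labels are ignored. -/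
def eval (f : GraphParameter) : LabeledClass k → ℝ :=
  Quotient.lift (fun F => f F.toFinGraph) fun _ _ h => f.iso_inv _ _ h.toFinGraph

/-- The classes of the `k`-labeled graphs whose labeled nodes are independent. -/
def indep (k : ℕ) : Submonoid (LabeledClass k) where
  carrier := {c | Quotient.lift LabeledGraph.LabelsIndep
    (fun _ _ h => propext ⟨.of_iso h, .of_iso h.symm⟩) c}
  mul_mem' := by
    rintro ⟨F⟩ ⟨G⟩ hF hG
    exact LabeledGraph.LabelsIndep.glue hF hG
  one_mem' := LabeledGraph.labelsIndep_edgeless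

theorem mk_mem_indep {F : LabeledGraph k} : mk F ∈ indep k ↔ F.LabelsIndep := Iff.rfl

/-- The map `F ↦ F'` on classes. -/
def contractFun (c : indep 2) : LabeledClass 1 :=
  Quotient.hrecOn (motive := fun c => c ∈ indep 2 → LabeledClass 1) c.1
    (fun F h => mk (F.contract h))
    (fun F G h => by
      apply Function.hfunext
      · exact propext ⟨fun hF => LabeledGraph.LabelsIndep.of_iso h hF,
          fun hG => LabeledGraph.LabelsIndep.of_iso h.symm hG⟩
      · intro hF hG _
        exact heq_of_eq (Quotient.sound (h.contract hF hG))) c.2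

theorem contractFun_mk (F : LabeledGraph 2) (h : F.LabelsIndep) :
    contractFun ⟨mk F, h⟩ = mk (F.contract h) := rfl

/-- The map `F ↦ F'` as a homomorphism of monoids. -/
def contract : indep 2 →* LabeledClass 1 where
  toFun := contractFun
  map_one' := by
    refine Quotient.sound ⟨Equiv.refl _, ?_⟩
    simp [LabeledGraph.contract, LabeledGraph.edgeless]
  map_mul' := by
    rintro ⟨⟨F⟩, hF⟩ ⟨⟨G⟩, hG⟩
    refine Quotient.sound ⟨Equiv.refl _, ?_⟩
    simp only [LabeledGraph.contract, LabeledGraph.glue, LabeledGraph.mergeNodes,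
      Multiset.map_add, LabeledGraph.map_map_edges]
    exact congrArg₂ _ (LabeledGraph.map_edges_congr (by rintro (i | u) <;> rfl) _)
      (LabeledGraph.map_edges_congr (by rintro (i | u) <;> rfl) _)

end LabeledClass

/-- The algebra `𝒢_k` of `k`-labeled quantum graphs: finite formal real linear combinations of
`k`-labeled graphs, with the bilinear extension of the gluing product. -/
abbrev QuantumGraph (k : ℕ) : Type 1 := MonoidAlgebra ℝ (LabeledClass k)

/-- The algebra `𝒢⁰_k` of linear combinations of `k`-labeled graphs whose labeled nodes are
independent. -/
abbrev IndepQuantumGraph (k : ℕ) : Type 1 := MonoidAlgebra ℝ (LabeledClass.indep k)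

/-- The inclusion of `𝒢⁰_k` in `𝒢_k`. -/
noncomputable def IndepQuantumGraph.incl (k : ℕ) : IndepQuantumGraph k →ₐ[ℝ] QuantumGraph k :=
  MonoidAlgebra.mapDomainAlgHom ℝ ℝ (LabeledClass.indep k).subtype

/-- The algebra homomorphism `x ↦ x'` from `𝒢⁰_2` to `𝒢_1`: the linear extension of the
identification of the two labeled nodes. -/
noncomputable def IndepQuantumGraph.contract : IndepQuantumGraph 2 →ₐ[ℝ] QuantumGraph 1 :=
  MonoidAlgebra.mapDomainAlgHom ℝ ℝ LabeledClass.contract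

namespace GraphParameter

/-- The linear extension of a graph parameter to quantum graphs. -/
noncomputable def eval (f : GraphParameter) {k : ℕ} : QuantumGraph k →ₗ[ℝ] ℝ :=
  Finsupp.linearCombination ℝ (LabeledClass.eval f) ∘ₗ
    (MonoidAlgebra.coeffLinearEquiv (M := LabeledClass k) (S := ℝ) ℝ).toLinearMap

theorem eval_single (f : GraphParameter) {k : ℕ} (F : LabeledGraph k) (a : ℝ) :
    f.eval (MonoidAlgebra.single (LabeledClass.mk F) a) = a * f F.toFinGraph := by
  change Finsupp.linearCombination ℝ (LabeledClass.eval f)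
    (Finsupp.single (LabeledClass.mk F) a) = _
  rw [Finsupp.linearCombination_single]
  rfl

/-- `f(x²) ≥ 0` for every `k` and every `k`-labeled quantum graph `x`. -/
def ReflectionPositive (f : GraphParameter) : Prop :=
  ∀ (k : ℕ) (x : QuantumGraph k), 0 ≤ f.eval (x * x)

/-- `z` is a contractor for `f` if `f(xz) = f(x')` for every `x ∈ 𝒢⁰_2`. -/
def IsContractor (f : GraphParameter) (z : QuantumGraph 2) : Prop :=
  ∀ x : IndepQuantumGraph 2, f.eval (IndepQuantumGraph.incl 2 x * z) = f.eval x.contract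

end GraphParameter

end GraphAlg

/-!
A homomorphism function `f = hom(·, H)` is a sum over the maps `φ` of the labels into `V(H)` of
positive multiples of characters `x ↦ hom_φ(x)` of the algebra of labeled quantum graphs
(`WeightedGraph.eval_eq_sum_homExtAlg`).  Hence it is reflection positive, and a contractor is
obtained by orthogonally projecting the vector with entries `δ_{ij}` to the finite-dimensional space
of vectors `(√(α_i α_j) hom_{ij}(x))_{ij}` (`WeightedGraph.exists_isContractor_of_eq_hom`).

For the converse, `c = f(K₁)` is nonnegative.  If `c = 0`, the Cauchy–Schwarz inequality shows that
`f` vanishes on every graph with a node, and `H` is empty.  If `c > 0`, then `f(F) / c^{|V(F)|}` does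
not depend on isolated nodes, so it defines compatible functionals on the algebras of quantum graphs
with any finite set `L` of roots, and more roots can be added at will.

A state is a quantum graph `p` with roots `L`, such that `x ↦ f(px)` is positive, normalised, and
multiplicative on the quantum graphs with roots `L`; an example is `p = 1` with `L` empty.  Given the
state, quantum graphs on disjoint sets of further roots are independent
(`RootedAlgebra.IsState.condValue_mul`).  The contractor `z` bounds the algebra with one further root
modulo its null ideal: if `x₁, …, xₙ` are orthonormal there, then the elements `xᵢ ⊗ xᵢ` with two
further roots are orthonormal, and the inner product of each of them with `z` is `1`, so Bessel's
inequality gives `n ≤ f(z²)` (`RootedAlgebra.IsState.card_le_of_orthonormal`).  A commutative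
algebra of finite dimension with a positive definite functional `f(px)` is `ℝ^d`
(`exists_algHom_pi`).  Let `e₁, …, e_d` represent its minimal idempotents.

Multiplying `p` by some `eᵢ` on a new root gives a state again, whose dimension is at least `d`.
Let `p` be a state with `d` maximal.  Then the dimension stays `d`, so the idempotents `eⱼ` of a
second new root remain minimal in the presence of `eᵢ` (`RootedAlgebra.exists_rigid_state`).
Therefore the edge between the two new roots acts on `eᵢ ⊗ eⱼ` as a scalar `β(i, j)`.  Rooting all the
nodes of a graph `F` and expanding `1 = ∏_v ∑_i e_i` then gives
`f(F) = c^{|V(F)|} ∑_ψ ∏_v f(p e_{ψ(v)}) ∏_{uv} β(ψ(u), ψ(v))`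
(`RootedAlgebra.IsState.normalized_eq_sum`), which is `hom(F, H)` for the graph `H` with nodes
`1, …, d`, nodeweights `c f(p eᵢ)` and edgeweights `β`.
-/

namespace GraphAlg

/-! ### Linear extension -/

/-- The linear extension of a function on a monoid to the monoid algebra. -/
noncomputable def linExt {M E : Type*} [AddCommGroup E] [Module ℝ E] (v : M → E) :
    MonoidAlgebra ℝ M →ₗ[ℝ] E :=
  Finsupp.linearCombination ℝ v ∘ₗ
    (MonoidAlgebra.coeffLinearEquiv (M := M) (S := ℝ) ℝ).toLinearMap

theorem linExt_single {M E : Type*} [AddCommGroup E] [Module ℝ E] (v : M → E) (m : M) (r : ℝ) :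
    linExt v (MonoidAlgebra.single m r) = r • v m :=
  Finsupp.linearCombination_single ℝ r m

theorem linearMap_eq_of_single {M E : Type*} [AddCommGroup E] [Module ℝ E]
    {φ ψ : MonoidAlgebra ℝ M →ₗ[ℝ] E}
    (h : ∀ m, φ (MonoidAlgebra.single m 1) = ψ (MonoidAlgebra.single m 1)) (x : MonoidAlgebra ℝ M) :
    φ x = ψ x := by
  induction x using MonoidAlgebra.induction_linear with
  | zero => simp
  | add x y hx hy => rw [map_add, map_add, hx, hy]
  | single m r =>
    have : MonoidAlgebra.single m r = r • MonoidAlgebra.single m (1 : ℝ) := by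
      rw [MonoidAlgebra.smul_single, smul_eq_mul, mul_one]
    rw [this, map_smul, map_smul, h]

/-! ### Graph parameters normalised by isolated nodes -/

section Normalized

open scoped Classical in
/-- The edges of a multiset that are not loops. -/
noncomputable def deleteLoops {X : Type} (E : Multiset (Sym2 X)) : Multiset (Sym2 X) :=
  E.filter fun e => ¬ e.IsDiag

open scoped Classical in
theorem not_isDiag_of_mem_deleteLoops {X : Type} {E : Multiset (Sym2 X)} :
    ∀ e ∈ deleteLoops E, ¬ e.IsDiag :=
  fun _ he => (Multiset.mem_filter.1 he).2

open scoped Classical in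
theorem deleteLoops_eq_self {X : Type} {E : Multiset (Sym2 X)} (h : ∀ e ∈ E, ¬ e.IsDiag) :
    deleteLoops E = E :=
  Multiset.filter_eq_self.2 h

open scoped Classical in
theorem deleteLoops_zero {X : Type} : deleteLoops (0 : Multiset (Sym2 X)) = 0 :=
  Multiset.filter_zero _

open scoped Classical in
theorem deleteLoops_add {X : Type} (E E' : Multiset (Sym2 X)) :
    deleteLoops (E + E') = deleteLoops E + deleteLoops E' :=
  Multiset.filter_add _ _ _

open scoped Classical in
theorem deleteLoops_map {X Y : Type} {φ : X → Y} (hφ : Function.Injective φ)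
    (E : Multiset (Sym2 X)) :
    deleteLoops (E.map (Sym2.map φ)) = (deleteLoops E).map (Sym2.map φ) := by
  rw [deleteLoops, deleteLoops, Multiset.filter_map]
  congr 1
  refine Multiset.filter_congr fun e _ => ?_
  simp only [Function.comp_apply, Sym2.isDiag_map hφ]

/-- The graph on the node set `X` with a given multiset of edges, loops being discarded. -/
noncomputable def FinGraph.ofEdges (X : Type) [Fintype X] (E : Multiset (Sym2 X)) : FinGraph where
  V := X
  edges := deleteLoops E
  loopless := not_isDiag_of_mem_deleteLoops

theorem FinGraph.ofEdges_edges (F : FinGraph) : FinGraph.ofEdges F.V F.edges = F := by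
  obtain ⟨V, E, h⟩ := F
  simp only [FinGraph.ofEdges, deleteLoops_eq_self h]

variable {X Y : Type} [Fintype X] [Fintype Y]

theorem FinGraph.iso_ofEdges_map (φ : X ≃ Y) (E : Multiset (Sym2 X)) :
    (FinGraph.ofEdges X E).Iso (FinGraph.ofEdges Y (E.map (Sym2.map φ))) :=
  ⟨φ, (deleteLoops_map φ.injective E).symm⟩

theorem FinGraph.ofEdges_sum (E : Multiset (Sym2 X)) (E' : Multiset (Sym2 Y)) :
    FinGraph.ofEdges (X ⊕ Y) (E.map (Sym2.map Sum.inl) + E'.map (Sym2.map Sum.inr)) =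
      (FinGraph.ofEdges X E).disjUnion (FinGraph.ofEdges Y E') := by
  simp only [FinGraph.ofEdges, FinGraph.disjUnion, FinGraph.mk.injEq, heq_eq_eq, true_and,
    deleteLoops_add]
  rw [deleteLoops_map Sum.inl_injective, deleteLoops_map Sum.inr_injective]
  exact ⟨rfl, rfl⟩

namespace GraphParameter

variable (f : GraphParameter)

/-- The value of `f` on the graph with a single node. -/
noncomputable def nodeValue : ℝ := f (FinGraph.ofEdges Unit 0)

/-- The value of a graph parameter on a graph, loops being discarded, divided by the value of the
edgeless graph on the same nodes.  It does not depend on isolated nodes. -/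
noncomputable def normalized (X : Type) [Fintype X] (E : Multiset (Sym2 X)) : ℝ :=
  f (FinGraph.ofEdges X E) / f.nodeValue ^ Fintype.card X

theorem apply_ofEdges_map (φ : X ≃ Y) (E : Multiset (Sym2 X)) :
    f (FinGraph.ofEdges Y (E.map (Sym2.map φ))) = f (FinGraph.ofEdges X E) :=
  (f.iso_inv _ _ (FinGraph.iso_ofEdges_map φ E)).symm

variable {f}

theorem apply_ofEdges_sum (hmul : f.Multiplicative) (E : Multiset (Sym2 X))
    (E' : Multiset (Sym2 Y)) :
    f (FinGraph.ofEdges (X ⊕ Y) (E.map (Sym2.map Sum.inl) + E'.map (Sym2.map Sum.inr))) =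
      f (FinGraph.ofEdges X E) * f (FinGraph.ofEdges Y E') := by
  rw [FinGraph.ofEdges_sum, hmul]

theorem apply_ofEdges_empty (h0 : ∃ F : FinGraph, f F ≠ 0) (hmul : f.Multiplicative)
    (X : Type) [Fintype X] [IsEmpty X] : f (FinGraph.ofEdges X 0) = 1 := by
  obtain ⟨F, hF⟩ := h0
  have h := apply_ofEdges_sum hmul F.edges (0 : Multiset (Sym2 X))
  have h' := f.apply_ofEdges_map (Equiv.sumEmpty F.V X).symm F.edges
  rw [Multiset.map_zero, add_zero] at h
  have h'' : f (FinGraph.ofEdges F.V F.edges) = f F := by rw [FinGraph.ofEdges_edges]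
  have : f F = f F * f (FinGraph.ofEdges X 0) := by
    rw [← h'', ← h, h'.symm]; rfl
  exact (mul_eq_left₀ hF).1 this.symm

theorem apply_ofEdges_zero (h0 : ∃ F : FinGraph, f F ≠ 0) (hmul : f.Multiplicative)
    (X : Type) [hX : Fintype X] :
    f (FinGraph.ofEdges X 0) = f.nodeValue ^ Fintype.card X := by
  refine Fintype.induction_empty_option
    (P := fun X _ => f (FinGraph.ofEdges X 0) = f.nodeValue ^ Fintype.card X)
    (fun X Y _ e ih => ?_) ?_ (fun X _ ih => ?_) X
  · let _ := Fintype.ofEquiv Y e.symm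
    rw [← Fintype.card_congr e, ← ih, ← f.apply_ofEdges_map e, Multiset.map_zero]
  · rw [apply_ofEdges_empty h0 hmul]; simp
  · have h := apply_ofEdges_sum hmul (0 : Multiset (Sym2 X)) (0 : Multiset (Sym2 Unit))
    have h' := f.apply_ofEdges_map (Equiv.optionEquivSumPUnit X) 0
    rw [ih] at h
    rw [Fintype.card_option, pow_succ, ← h', Multiset.map_zero]
    exact h

/-- Nodes outside the image of `φ` are isolated, and the normalisation cancels their contribution. -/
theorem normalized_map (h0 : ∃ F : FinGraph, f F ≠ 0) (hmul : f.Multiplicative)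
    (hc : f.nodeValue ≠ 0) {φ : X → Y} (hφ : Function.Injective φ) (E : Multiset (Sym2 X)) :
    f.normalized Y (E.map (Sym2.map φ)) = f.normalized X E := by
  classical
  let Z := {y : Y // y ∉ Set.range φ}
  let e : X ⊕ Z ≃ Y :=
    (Equiv.sumCongr (Equiv.ofInjective φ hφ) (Equiv.refl _)).trans
      (Equiv.sumCompl (· ∈ Set.range φ))
  have h := apply_ofEdges_sum hmul E (0 : Multiset (Sym2 Z))
  rw [Multiset.map_zero, add_zero, ← f.apply_ofEdges_map e, LabeledGraph.map_map_edges,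
    apply_ofEdges_zero h0 hmul] at h
  have he : (e ∘ Sum.inl : X → Y) = φ := by
    funext x
    exact Equiv.sumCompl_apply_inl (p := (· ∈ Set.range φ)) ⟨φ x, x, rfl⟩
  rw [he] at h
  rw [normalized, normalized, h, ← Fintype.card_congr e, Fintype.card_sum, pow_add]
  exact mul_div_mul_right _ _ (pow_ne_zero _ hc)

theorem normalized_sum (hmul : f.Multiplicative) (E : Multiset (Sym2 X))
    (E' : Multiset (Sym2 Y)) :
    f.normalized (X ⊕ Y) (E.map (Sym2.map Sum.inl) + E'.map (Sym2.map Sum.inr)) =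
      f.normalized X E * f.normalized Y E' := by
  rw [normalized, normalized, normalized, apply_ofEdges_sum hmul, Fintype.card_sum, pow_add,
    mul_div_mul_comm]

end GraphParameter

end Normalized

/-! ### Graphs with an arbitrary set of roots -/

/-- A graph some of whose nodes are the elements of a set `L` of roots; the other nodes form a
finite set `U`.  Loops are allowed, but they will be discarded when a parameter is evaluated: this
makes the graphs on given nodes closed under every map of the nodes. -/
structure RootedGraph (L : Type) : Type 1 where
  U : Type
  [fintypeU : Fintype U]
  edges : Multiset (Sym2 (L ⊕ U))

attribute [instance] RootedGraph.fintypeU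

namespace RootedGraph

open LabeledGraph (map_map_edges map_edges_congr map_edges_id)

variable {L L' L'' T T' : Type}

/-- Root-preserving isomorphism. -/
def Iso (F G : RootedGraph L) : Prop :=
  ∃ φ : F.U ≃ G.U, F.edges.map (Sym2.map (Sum.map id φ)) = G.edges

theorem Iso.refl (F : RootedGraph L) : F.Iso F := ⟨Equiv.refl _, by simp⟩

theorem Iso.symm {F G : RootedGraph L} (h : F.Iso G) : G.Iso F := by
  obtain ⟨φ, h⟩ := h
  refine ⟨φ.symm, ?_⟩
  rw [← h, map_map_edges]
  exact map_edges_id (by rintro (i | u) <;> simp) _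

theorem Iso.trans {F G H : RootedGraph L} (h : F.Iso G) (h' : G.Iso H) : F.Iso H := by
  obtain ⟨φ, h⟩ := h
  obtain ⟨ψ, h'⟩ := h'
  refine ⟨φ.trans ψ, ?_⟩
  rw [← h', ← h, map_map_edges]
  exact map_edges_congr (by rintro (i | u) <;> simp) _

instance setoid (L : Type) : Setoid (RootedGraph L) :=
  ⟨Iso, ⟨Iso.refl, Iso.symm, Iso.trans⟩⟩

/-- The disjoint union of two rooted graphs with equal roots identified. -/
def glue (F G : RootedGraph L) : RootedGraph L where
  U := F.U ⊕ G.U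
  edges := F.edges.map (Sym2.map (Sum.map id Sum.inl)) +
    G.edges.map (Sym2.map (Sum.map id Sum.inr))

/-- The rooted graph without unrooted nodes and with the given edges. -/
def ofEdges (E : Multiset (Sym2 L)) : RootedGraph L where
  U := Empty
  edges := E.map (Sym2.map Sum.inl)

/-- The image of a rooted graph under a map of the roots. -/
def map (φ : L → L') (F : RootedGraph L) : RootedGraph L' where
  U := F.U
  edges := F.edges.map (Sym2.map (Sum.map φ id))

/-- Turn the roots in `T` into ordinary nodes. -/
def unroot [Fintype T] (F : RootedGraph (L ⊕ T)) : RootedGraph L where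
  U := T ⊕ F.U
  edges := F.edges.map (Sym2.map (Equiv.sumAssoc L T F.U))

theorem Iso.glue {F F' G G' : RootedGraph L} (h : F.Iso F') (h' : G.Iso G') :
    (F.glue G).Iso (F'.glue G') := by
  obtain ⟨φ, h⟩ := h
  obtain ⟨ψ, h'⟩ := h'
  refine ⟨Equiv.sumCongr φ ψ, ?_⟩
  simp only [RootedGraph.glue, ← h, ← h', Multiset.map_add, map_map_edges]
  exact congrArg₂ _ (map_edges_congr (by rintro (i | u) <;> rfl) _)
    (map_edges_congr (by rintro (i | u) <;> rfl) _)

theorem glue_assoc (F G H : RootedGraph L) :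
    ((F.glue G).glue H).Iso (F.glue (G.glue H)) := by
  refine ⟨Equiv.sumAssoc _ _ _, ?_⟩
  simp only [RootedGraph.glue, Multiset.map_add, map_map_edges, add_assoc]
  exact congrArg₂ _ (map_edges_congr (by rintro (i | u) <;> rfl) _)
    (congrArg₂ _ (map_edges_congr (by rintro (i | u) <;> rfl) _)
      (map_edges_congr (by rintro (i | u) <;> rfl) _))

theorem glue_comm (F G : RootedGraph L) : (F.glue G).Iso (G.glue F) := by
  refine ⟨Equiv.sumComm _ _, ?_⟩
  simp only [RootedGraph.glue, Multiset.map_add, map_map_edges]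
  rw [add_comm]
  exact congrArg₂ _ (map_edges_congr (by rintro (i | u) <;> rfl) _)
    (map_edges_congr (by rintro (i | u) <;> rfl) _)

theorem ofEdges_glue (F : RootedGraph L) : ((ofEdges 0).glue F).Iso F := by
  refine ⟨Equiv.emptySum Empty _, ?_⟩
  simp only [RootedGraph.glue, ofEdges, Multiset.map_zero, zero_add, map_map_edges]
  exact map_edges_id (by rintro (i | u) <;> rfl) _

theorem ofEdges_add (E E' : Multiset (Sym2 L)) :
    ((ofEdges E).glue (ofEdges E')).Iso (ofEdges (E + E')) := by
  refine ⟨Equiv.emptySum Empty _, ?_⟩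
  simp only [RootedGraph.glue, ofEdges, Multiset.map_add, map_map_edges]
  exact congrArg₂ _ (map_edges_congr (fun _ => rfl) _) (map_edges_congr (fun _ => rfl) _)

theorem Iso.map (φ : L → L') {F G : RootedGraph L} (h : F.Iso G) :
    (F.map φ).Iso (G.map φ) := by
  obtain ⟨ψ, h⟩ := h
  refine ⟨ψ, ?_⟩
  simp only [RootedGraph.map, ← h, map_map_edges]
  exact map_edges_congr (by rintro (i | u) <;> rfl) _

theorem map_ofEdges_zero (φ : L → L') : ((ofEdges 0).map φ).Iso (ofEdges 0) :=
  ⟨Equiv.refl _, by simp [RootedGraph.map, ofEdges]⟩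

theorem map_ofEdges (φ : L → L') (E : Multiset (Sym2 L)) :
    ((ofEdges E).map φ).Iso (ofEdges (E.map (Sym2.map φ))) := by
  refine ⟨Equiv.refl _, ?_⟩
  simp only [RootedGraph.map, ofEdges, map_map_edges]
  exact map_edges_congr (fun _ => rfl) _

theorem map_glue (φ : L → L') (F G : RootedGraph L) :
    ((F.glue G).map φ).Iso ((F.map φ).glue (G.map φ)) := by
  refine ⟨Equiv.refl _, ?_⟩
  simp only [RootedGraph.map, RootedGraph.glue, Multiset.map_add, map_map_edges]
  exact congrArg₂ _ (map_edges_congr (by rintro (i | u) <;> rfl) _)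
    (map_edges_congr (by rintro (i | u) <;> rfl) _)

theorem map_map (φ : L → L') (ψ : L' → L'') (F : RootedGraph L) :
    ((F.map φ).map ψ).Iso (F.map (ψ ∘ φ)) := by
  refine ⟨Equiv.refl _, ?_⟩
  simp only [RootedGraph.map, map_map_edges]
  exact map_edges_congr (by rintro (i | u) <;> rfl) _

section unroot

variable [Fintype T] [Fintype T']

theorem Iso.unroot {F G : RootedGraph (L ⊕ T)} (h : F.Iso G) : F.unroot.Iso G.unroot := by
  obtain ⟨ψ, h⟩ := h
  refine ⟨Equiv.sumCongr (Equiv.refl _) ψ, ?_⟩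
  simp only [RootedGraph.unroot, ← h, map_map_edges]
  exact map_edges_congr (by rintro ((i | t) | u) <;> rfl) _

theorem unroot_map_inl_glue (F : RootedGraph L) (G : RootedGraph (L ⊕ T)) :
    ((F.map Sum.inl).glue G).unroot.Iso (F.glue G.unroot) := by
  refine ⟨(Equiv.sumAssoc _ _ _).symm.trans
    ((Equiv.sumCongr (Equiv.sumComm _ _) (Equiv.refl _)).trans (Equiv.sumAssoc _ _ _)), ?_⟩
  simp only [RootedGraph.unroot, RootedGraph.glue, RootedGraph.map, Multiset.map_add,
    map_map_edges]
  exact congrArg₂ _ (map_edges_congr (by rintro (i | u) <;> rfl) _)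
    (map_edges_congr (by rintro ((i | t) | u) <;> rfl) _)

theorem unroot_glue (F : RootedGraph (L ⊕ T)) (G : RootedGraph (L ⊕ T')) :
    ((F.map (Sum.map id Sum.inl)).glue (G.map (Sum.map id Sum.inr)) :
      RootedGraph (L ⊕ (T ⊕ T'))).unroot.Iso (F.unroot.glue G.unroot) := by
  refine ⟨Equiv.sumSumSumComm _ _ _ _, ?_⟩
  simp only [RootedGraph.unroot, RootedGraph.glue, RootedGraph.map, Multiset.map_add,
    map_map_edges]
  exact congrArg₂ _ (map_edges_congr (by rintro ((i | t) | u) <;> rfl) _)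
    (map_edges_congr (by rintro ((i | t) | u) <;> rfl) _)

end unroot

end RootedGraph

/-- Rooted graphs up to root-preserving isomorphism. -/
def RootedClass (L : Type) : Type 1 := Quotient (RootedGraph.setoid L)

namespace RootedClass

variable {L L' L'' T T' : Type}

/-- The isomorphism class of a rooted graph. -/
def mk (F : RootedGraph L) : RootedClass L := Quotient.mk _ F

instance : CommMonoid (RootedClass L) where
  mul := Quotient.map₂ RootedGraph.glue fun _ _ h _ _ h' => h.glue h'
  one := mk (RootedGraph.ofEdges 0)
  mul_assoc := by
    rintro ⟨F⟩ ⟨G⟩ ⟨H⟩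
    exact Quotient.sound (RootedGraph.glue_assoc F G H)
  mul_comm := by
    rintro ⟨F⟩ ⟨G⟩
    exact Quotient.sound (RootedGraph.glue_comm F G)
  one_mul := by
    rintro ⟨F⟩
    exact Quotient.sound (RootedGraph.ofEdges_glue F)
  mul_one := by
    rintro ⟨F⟩
    exact Quotient.sound ((RootedGraph.glue_comm _ _).trans (RootedGraph.ofEdges_glue F))

theorem mk_mul_mk (F G : RootedGraph L) : mk F * mk G = mk (F.glue G) := rfl

/-- The map of classes induced by a map of the roots. -/
def map (φ : L → L') : RootedClass L →* RootedClass L' where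
  toFun := Quotient.map (RootedGraph.map φ) fun _ _ h => h.map φ
  map_one' := Quotient.sound (RootedGraph.map_ofEdges_zero φ)
  map_mul' := by
    rintro ⟨F⟩ ⟨G⟩
    exact Quotient.sound (RootedGraph.map_glue φ F G)

theorem map_mk (φ : L → L') (F : RootedGraph L) : map φ (mk F) = mk (F.map φ) := rfl

theorem map_map (φ : L → L') (ψ : L' → L'') (c : RootedClass L) :
    map ψ (map φ c) = map (ψ ∘ φ) c := by
  obtain ⟨F⟩ := c
  exact Quotient.sound (F.map_map φ ψ)

/-- Turning the roots in `T` into ordinary nodes. -/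
def unroot [Fintype T] : RootedClass (L ⊕ T) → RootedClass L :=
  Quotient.map RootedGraph.unroot fun _ _ h => h.unroot

/-- The class of the graph on the roots with the given edges. -/
def ofEdges (E : Multiset (Sym2 L)) : RootedClass L := mk (RootedGraph.ofEdges E)

theorem ofEdges_add (E E' : Multiset (Sym2 L)) : ofEdges (E + E') = ofEdges E * ofEdges E' :=
  (Quotient.sound (RootedGraph.ofEdges_add E E')).symm

theorem map_ofEdges (φ : L → L') (E : Multiset (Sym2 L)) :
    map φ (ofEdges E) = ofEdges (E.map (Sym2.map φ)) :=
  Quotient.sound (RootedGraph.map_ofEdges φ E)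

/-- The normalised value of a parameter, the roots being forgotten. -/
noncomputable def value (f : GraphParameter) [Fintype L] : RootedClass L → ℝ :=
  Quotient.lift (fun F => f.normalized (L ⊕ F.U) F.edges) <| by
    rintro F G ⟨φ, h⟩
    have := f.apply_ofEdges_map (Equiv.sumCongr (Equiv.refl L) φ) F.edges
    simp only [GraphParameter.normalized]
    rw [← this, Fintype.card_congr (Equiv.sumCongr (Equiv.refl L) φ), ← h]
    rfl

theorem value_mk (f : GraphParameter) [Fintype L] (F : RootedGraph L) :
    value f (mk F) = f.normalized (L ⊕ F.U) F.edges := rfl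

end RootedClass

open LabeledGraph (map_map_edges map_edges_congr map_edges_id)

/-! ### The algebras of rooted quantum graphs -/

/-- The algebra of formal real linear combinations of rooted graphs with root set `L`. -/
abbrev RootedAlgebra (L : Type) : Type 1 := MonoidAlgebra ℝ (RootedClass L)

theorem GraphParameter.normalized_equiv (f : GraphParameter) {X Y : Type} [Fintype X] [Fintype Y]
    (φ : X ≃ Y) (E : Multiset (Sym2 X)) :
    f.normalized Y (E.map (Sym2.map φ)) = f.normalized X E := by
  rw [normalized, normalized, apply_ofEdges_map, Fintype.card_congr φ]

namespace RootedAlgebra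

variable {L L' L'' T T' : Type}

/-- The homomorphism of algebras induced by a map of the roots. -/
noncomputable def map (φ : L → L') : RootedAlgebra L →ₐ[ℝ] RootedAlgebra L' :=
  MonoidAlgebra.mapDomainAlgHom ℝ ℝ (RootedClass.map φ)

theorem map_single (φ : L → L') (c : RootedClass L) (r : ℝ) :
    map φ (MonoidAlgebra.single c r) = MonoidAlgebra.single (RootedClass.map φ c) r :=
  MonoidAlgebra.mapDomain_single

theorem map_map (φ : L → L') (ψ : L' → L'') (x : RootedAlgebra L) :
    map ψ (map φ x) = map (ψ ∘ φ) x := by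
  refine linearMap_eq_of_single
    (φ := (map ψ).toLinearMap ∘ₗ (map φ).toLinearMap) (ψ := (map (ψ ∘ φ)).toLinearMap)
    (fun c => ?_) x
  change map ψ (map φ _) = map _ _
  rw [map_single, map_single, map_single, RootedClass.map_map]

theorem map_id (x : RootedAlgebra L) : map id x = x := by
  refine linearMap_eq_of_single (φ := (map id).toLinearMap) (ψ := LinearMap.id) (fun c => ?_) x
  obtain ⟨F⟩ := c
  change map id (MonoidAlgebra.single (RootedClass.mk F) 1) =
    MonoidAlgebra.single (RootedClass.mk F) 1
  rw [map_single, RootedClass.map_mk]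
  congr 1
  refine Quotient.sound ⟨Equiv.refl _, ?_⟩
  simp only [RootedGraph.map, map_map_edges]
  exact map_edges_id (by rintro (i | u) <;> rfl) _

/-- The linear map that turns the roots in `T` into ordinary nodes. -/
noncomputable def unroot [Fintype T] : RootedAlgebra (L ⊕ T) →ₗ[ℝ] RootedAlgebra L :=
  linExt fun c => MonoidAlgebra.single c.unroot 1

theorem unroot_single [Fintype T] (c : RootedClass (L ⊕ T)) (r : ℝ) :
    unroot (MonoidAlgebra.single c r) = MonoidAlgebra.single c.unroot r := by
  rw [unroot, linExt_single, MonoidAlgebra.smul_single, smul_eq_mul, mul_one]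

theorem unroot_map_inl_mul [Fintype T] (x : RootedAlgebra L) (y : RootedAlgebra (L ⊕ T)) :
    unroot (map Sum.inl x * y) = x * unroot y := by
  induction x using MonoidAlgebra.induction_linear with
  | zero => simp
  | add x x' hx hx' => simp only [map_add, add_mul, hx, hx']
  | single c r =>
    induction y using MonoidAlgebra.induction_linear with
    | zero => simp
    | add y y' hy hy' => simp only [map_add, mul_add, hy, hy']
    | single d s =>
      rw [map_single, unroot_single, MonoidAlgebra.single_mul_single,
        MonoidAlgebra.single_mul_single, unroot_single]
      congr 1
      obtain ⟨F⟩ := c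
      obtain ⟨G⟩ := d
      exact Quotient.sound (RootedGraph.unroot_map_inl_glue F G)

theorem unroot_mul [Fintype T] [Fintype T'] (x : RootedAlgebra (L ⊕ T))
    (y : RootedAlgebra (L ⊕ T')) :
    unroot (map (Sum.map id Sum.inl) x * map (Sum.map id Sum.inr) y :
      RootedAlgebra (L ⊕ (T ⊕ T'))) = unroot x * unroot y := by
  induction x using MonoidAlgebra.induction_linear with
  | zero => simp
  | add x x' hx hx' => simp only [map_add, add_mul, hx, hx']
  | single c r =>
    induction y using MonoidAlgebra.induction_linear with
    | zero => simp
    | add y y' hy hy' => simp only [map_add, mul_add, hy, hy']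
    | single d s =>
      rw [map_single, map_single, unroot_single, unroot_single, MonoidAlgebra.single_mul_single,
        MonoidAlgebra.single_mul_single, unroot_single]
      congr 1
      obtain ⟨F⟩ := c
      obtain ⟨G⟩ := d
      exact Quotient.sound (RootedGraph.unroot_glue F G)

variable (f : GraphParameter)

/-- The linear extension of the normalised parameter. -/
noncomputable def value [Fintype L] : RootedAlgebra L →ₗ[ℝ] ℝ := linExt (RootedClass.value f)

theorem value_single [Fintype L] (c : RootedClass L) (r : ℝ) :
    value f (MonoidAlgebra.single c r) = r * RootedClass.value f c := linExt_single _ _ _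

theorem value_unroot [Fintype L] [Fintype T] (x : RootedAlgebra (L ⊕ T)) :
    value f (unroot x) = value f x := by
  refine linearMap_eq_of_single (φ := value f ∘ₗ unroot) (ψ := value f) (fun c => ?_) x
  rw [LinearMap.comp_apply, unroot_single, value_single, value_single]
  congr 1
  obtain ⟨F⟩ := c
  exact f.normalized_equiv (Equiv.sumAssoc L T F.U) F.edges

section

variable {f} (h0 : ∃ F : FinGraph, f F ≠ 0) (hmul : f.Multiplicative)

include h0 hmul in
theorem value_map [Fintype L] [Fintype L'] (hc : f.nodeValue ≠ 0) {φ : L → L'}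
    (hφ : Function.Injective φ) (x : RootedAlgebra L) : value f (map φ x) = value f x := by
  refine linearMap_eq_of_single (φ := value f ∘ₗ (map φ).toLinearMap) (ψ := value f)
    (fun c => ?_) x
  rw [LinearMap.comp_apply, AlgHom.toLinearMap_apply, map_single, value_single, value_single]
  congr 1
  obtain ⟨F⟩ := c
  exact GraphParameter.normalized_map h0 hmul hc (hφ.sumMap Function.injective_id) F.edges

include h0 hmul in
theorem value_one [Fintype L] (hc : f.nodeValue ≠ 0) : value f (1 : RootedAlgebra L) = 1 := by
  rw [MonoidAlgebra.one_def, value_single, one_mul]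
  change f.normalized (L ⊕ Empty) (Multiset.map _ 0) = 1
  rw [Multiset.map_zero, GraphParameter.normalized, GraphParameter.apply_ofEdges_zero h0 hmul,
    div_self (pow_ne_zero _ hc)]

include hmul in
theorem value_map_inl_mul_map_inr [Fintype L] [Fintype T] (x : RootedAlgebra L)
    (y : RootedAlgebra T) :
    value f (map Sum.inl x * map Sum.inr y : RootedAlgebra (L ⊕ T)) = value f x * value f y := by
  induction x using MonoidAlgebra.induction_linear with
  | zero => simp
  | add x x' hx hx' => simp only [map_add, add_mul, hx, hx']
  | single c r =>
    induction y using MonoidAlgebra.induction_linear with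
    | zero => simp
    | add y y' hy hy' => simp only [map_add, mul_add, hy, hy']
    | single d s =>
      rw [map_single, map_single, MonoidAlgebra.single_mul_single, value_single, value_single,
        value_single, mul_mul_mul_comm]
      congr 1
      obtain ⟨F⟩ := c
      obtain ⟨G⟩ := d
      have h := GraphParameter.normalized_sum hmul F.edges G.edges
      refine ((f.normalized_equiv (Equiv.sumSumSumComm L T F.U G.U)
        ((F.map Sum.inl).glue (G.map Sum.inr)).edges).symm.trans ?_).trans h
      refine congrArg (f.normalized _) ?_
      simp only [RootedGraph.map, RootedGraph.glue, Multiset.map_add, map_map_edges]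
      exact congrArg₂ _ (map_edges_congr (by rintro (i | u) <;> rfl) _)
        (map_edges_congr (by rintro (i | u) <;> rfl) _)

end

end RootedAlgebra

/-! ### Reflection positivity of the normalised parameter -/

namespace RootedGraph

variable {k : ℕ}

/-- The labeled graph obtained from a rooted graph by deleting the loops. -/
noncomputable def toLabeled (F : RootedGraph (Fin k)) : LabeledGraph k where
  U := F.U
  edges := deleteLoops F.edges
  loopless := not_isDiag_of_mem_deleteLoops

theorem Iso.toLabeled {F G : RootedGraph (Fin k)} (h : F.Iso G) :
    F.toLabeled.Iso G.toLabeled := by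
  obtain ⟨φ, h⟩ := h
  refine ⟨φ, ?_⟩
  simp only [RootedGraph.toLabeled, ← h]
  exact (deleteLoops_map (Function.injective_id.sumMap φ.injective) _).symm

theorem toLabeled_glue (F G : RootedGraph (Fin k)) :
    (F.glue G).toLabeled = F.toLabeled.glue G.toLabeled := by
  simp only [toLabeled, glue, LabeledGraph.glue, deleteLoops_add]
  rw [LabeledGraph.mk.injEq]
  refine ⟨rfl, HEq.rfl, heq_of_eq ?_⟩
  exact congrArg₂ _
    (deleteLoops_map (Function.injective_id.sumMap Sum.inl_injective) _)
    (deleteLoops_map (Function.injective_id.sumMap Sum.inr_injective) _)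

end RootedGraph

namespace RootedClass

/-- The labeled class of a rooted class with roots `1, …, k`, weighted by the reciprocal of
the normalising factor of its unrooted nodes. -/
noncomputable def toQuantumGraph (f : GraphParameter) (k : ℕ) :
    RootedClass (Fin k) →* QuantumGraph k where
  toFun := Quotient.lift
    (fun F => MonoidAlgebra.single (LabeledClass.mk F.toLabeled)
      ((f.nodeValue ^ Fintype.card F.U)⁻¹)) <| by
    rintro F G h
    rw [show LabeledClass.mk F.toLabeled = LabeledClass.mk G.toLabeled from
      Quotient.sound h.toLabeled]
    obtain ⟨φ, -⟩ := h
    rw [Fintype.card_congr φ]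
  map_one' := by
    rw [MonoidAlgebra.one_def]
    change MonoidAlgebra.single (LabeledClass.mk (RootedGraph.ofEdges 0).toLabeled) _ = _
    have h : LabeledClass.mk (RootedGraph.ofEdges (0 : Multiset (Sym2 (Fin k)))).toLabeled = 1 :=
      Quotient.sound ⟨Equiv.refl _, by
        simp [RootedGraph.toLabeled, RootedGraph.ofEdges, LabeledGraph.edgeless,
          deleteLoops_zero]⟩
    have hU : Fintype.card (RootedGraph.ofEdges (0 : Multiset (Sym2 (Fin k)))).U = 0 :=
      Fintype.card_eq_zero_iff.2 (inferInstanceAs (IsEmpty Empty))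
    rw [h, hU, pow_zero, inv_one]
  map_mul' := by
    rintro ⟨F⟩ ⟨G⟩
    change MonoidAlgebra.single (LabeledClass.mk (F.glue G).toLabeled) _ =
      MonoidAlgebra.single (LabeledClass.mk F.toLabeled) _ *
        MonoidAlgebra.single (LabeledClass.mk G.toLabeled) _
    rw [MonoidAlgebra.single_mul_single, RootedGraph.toLabeled_glue, ← mul_inv, ← pow_add,
      ← Fintype.card_sum]
    rfl

end RootedClass

namespace RootedAlgebra

theorem eval_toQuantumGraph {f : GraphParameter} (hc : f.nodeValue ≠ 0) {k : ℕ}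
    (x : RootedAlgebra (Fin k)) :
    f.eval (MonoidAlgebra.lift ℝ _ _ (RootedClass.toQuantumGraph f k) x) =
      f.nodeValue ^ k * value f x := by
  refine linearMap_eq_of_single
    (φ := f.eval ∘ₗ (MonoidAlgebra.lift ℝ _ _ (RootedClass.toQuantumGraph f k)).toLinearMap)
    (ψ := (f.nodeValue ^ k) • value f) (fun c => ?_) x
  rw [LinearMap.comp_apply, AlgHom.toLinearMap_apply, MonoidAlgebra.lift_single, one_smul,
    LinearMap.smul_apply, value_single, one_mul, smul_eq_mul]
  obtain ⟨F⟩ := c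
  change f.eval (MonoidAlgebra.single (LabeledClass.mk F.toLabeled) _) =
    _ * f.normalized (Fin k ⊕ F.U) F.edges
  rw [GraphParameter.eval_single, GraphParameter.normalized, Fintype.card_sum, Fintype.card_fin,
    pow_add]
  have h : F.toLabeled.toFinGraph = FinGraph.ofEdges (Fin k ⊕ F.U) F.edges := rfl
  rw [h]
  field_simp

theorem value_mul_self_nonneg {f : GraphParameter} (h0 : ∃ F : FinGraph, f F ≠ 0)
    (hmul : f.Multiplicative) (hrp : f.ReflectionPositive) (hc : 0 < f.nodeValue)
    {L : Type} [Fintype L] (x : RootedAlgebra L) : 0 ≤ value f (x * x) := by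
  have e := Fintype.equivFin L
  have h := hrp _ (MonoidAlgebra.lift ℝ _ _ (RootedClass.toQuantumGraph f _) (map e x))
  rw [← map_mul, eval_toQuantumGraph hc.ne', ← map_mul, value_map h0 hmul hc.ne' e.injective] at h
  exact nonneg_of_mul_nonneg_right h (pow_pos hc _)

end RootedAlgebra

/-! ### The contractor of the normalised parameter -/

namespace RootedGraph

variable {L : Type} {U W : Type}

/-- Regard the last root as the node labeled `i` and the other roots as ordinary nodes. -/
def lastRootTo (i : Fin 2) (j : U → W) : (L ⊕ Unit) ⊕ U → Fin 2 ⊕ (L ⊕ W)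
  | Sum.inl (Sum.inl l) => Sum.inr (Sum.inl l)
  | Sum.inl (Sum.inr _) => Sum.inl i
  | Sum.inr u => Sum.inr (Sum.inr (j u))

theorem lastRootTo_injective (i : Fin 2) {j : U → W} (hj : Function.Injective j) :
    Function.Injective (lastRootTo (L := L) i j) := by
  rintro ((l | _) | u) ((l' | _) | u') h
  all_goals simp_all [lastRootTo]
  exact hj h

theorem lastRootTo_eq_inl {i i' : Fin 2} {j : U → W} {a : (L ⊕ Unit) ⊕ U}
    (h : lastRootTo i j a = Sum.inl i') : a = Sum.inl (Sum.inr ()) := by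
  obtain (l | _) | u := a
  · simp [lastRootTo] at h
  · rfl
  · simp [lastRootTo] at h

theorem lastRootTo_not_mem (i i₁ i₂ : Fin 2) {j : U → W} {E : Multiset (Sym2 ((L ⊕ Unit) ⊕ U))}
    (hE : ∀ e ∈ E, ¬ e.IsDiag) :
    s(Sum.inl i₁, Sum.inl i₂) ∉ E.map (Sym2.map (lastRootTo i j)) := by
  intro h
  obtain ⟨d, hd, hd'⟩ := Multiset.mem_map.1 h
  induction d using Sym2.ind with
  | _ a b =>
    refine hE _ hd ?_
    rw [Sym2.map_mk, Sym2.eq_iff] at hd'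
    rw [Sym2.mk_isDiag_iff]
    rcases hd' with ⟨h₁, h₂⟩ | ⟨h₁, h₂⟩ <;>
      rw [lastRootTo_eq_inl h₁, lastRootTo_eq_inl h₂]

variable [Fintype L]

/-- Two rooted graphs glued along all but the last root; the last roots of the two graphs carry
the labels `0` and `1`. -/
noncomputable def pair (F G : RootedGraph (L ⊕ Unit)) : LabeledGraph 2 where
  U := L ⊕ (F.U ⊕ G.U)
  edges := (deleteLoops F.edges).map (Sym2.map (lastRootTo 0 Sum.inl)) +
    (deleteLoops G.edges).map (Sym2.map (lastRootTo 1 Sum.inr))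
  loopless := by
    intro e he
    rw [Multiset.mem_add, Multiset.mem_map, Multiset.mem_map] at he
    rcases he with ⟨d, hd, rfl⟩ | ⟨d, hd, rfl⟩
    · rw [Sym2.isDiag_map (lastRootTo_injective _ Sum.inl_injective)]
      exact not_isDiag_of_mem_deleteLoops d hd
    · rw [Sym2.isDiag_map (lastRootTo_injective _ Sum.inr_injective)]
      exact not_isDiag_of_mem_deleteLoops d hd

theorem pair_labelsIndep (F G : RootedGraph (L ⊕ Unit)) : (F.pair G).LabelsIndep := by
  intro i j hij
  rcases Multiset.mem_add.1 hij with h | h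
  · exact lastRootTo_not_mem _ _ _ not_isDiag_of_mem_deleteLoops h
  · exact lastRootTo_not_mem _ _ _ not_isDiag_of_mem_deleteLoops h

/-- The nodes of `F.pair G` with its labels identified are those of `F.glue G`. -/
def contractEquiv (L W : Type) : Fin 1 ⊕ (L ⊕ W) ≃ (L ⊕ Unit) ⊕ W :=
  (Equiv.sumAssoc _ _ _).symm.trans <| Equiv.sumCongr
    ((Equiv.sumComm _ _).trans (Equiv.sumCongr (Equiv.refl _) (Equiv.equivPUnit _))) (Equiv.refl _)

theorem apply_contract_pair (f : GraphParameter) (F G : RootedGraph (L ⊕ Unit)) :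
    f ((F.pair G).contract (pair_labelsIndep F G)).toFinGraph =
      f (FinGraph.ofEdges _ (F.glue G).edges) := by
  refine (f.iso_inv _ _ ⟨contractEquiv L (F.U ⊕ G.U), ?_⟩)
  simp only [LabeledGraph.toFinGraph, LabeledGraph.contract, pair, FinGraph.ofEdges,
    RootedGraph.glue, deleteLoops_add, Multiset.map_add, map_map_edges]
  rw [deleteLoops_map (Function.injective_id.sumMap Sum.inl_injective),
    deleteLoops_map (Function.injective_id.sumMap Sum.inr_injective)]
  exact congrArg₂ _ (map_edges_congr (by rintro ((i | u) | u) <;> rfl) _)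
    (map_edges_congr (by rintro ((i | u) | u) <;> rfl) _)

/-- A pair of labels as a pair of roots. -/
def pairRoots : Fin 2 ≃ Unit ⊕ Unit where
  toFun := ![Sum.inl (), Sum.inr ()]
  invFun := Sum.elim (fun _ => 0) (fun _ => 1)
  left_inv := by intro i; fin_cases i <;> rfl
  right_inv := by rintro (_ | _) <;> rfl

/-- The rooted graph underlying a `2`-labeled graph. -/
def ofLabeled (Z : LabeledGraph 2) : RootedGraph (Unit ⊕ Unit) where
  U := Z.U
  edges := Z.edges.map (Sym2.map (Sum.map pairRoots id))

theorem ofLabeled_iso {Z Z' : LabeledGraph 2} (h : Z.Iso Z') :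
    (ofLabeled Z).Iso (ofLabeled Z') := by
  obtain ⟨φ, h⟩ := h
  refine ⟨φ, ?_⟩
  simp only [ofLabeled, ← h, map_map_edges]
  exact map_edges_congr (by rintro (i | u) <;> rfl) _

/-- The nodes of the product of `F.pair G` and a `2`-labeled graph. -/
def glueEquiv (L W Z : Type) : Fin 2 ⊕ ((L ⊕ W) ⊕ Z) ≃ (L ⊕ (Unit ⊕ Unit)) ⊕ (W ⊕ Z) where
  toFun
    | Sum.inl i => Sum.inl (Sum.inr (pairRoots i))
    | Sum.inr (Sum.inl (Sum.inl l)) => Sum.inl (Sum.inl l)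
    | Sum.inr (Sum.inl (Sum.inr w)) => Sum.inr (Sum.inl w)
    | Sum.inr (Sum.inr z) => Sum.inr (Sum.inr z)
  invFun
    | Sum.inl (Sum.inr i) => Sum.inl (pairRoots.symm i)
    | Sum.inl (Sum.inl l) => Sum.inr (Sum.inl (Sum.inl l))
    | Sum.inr (Sum.inl w) => Sum.inr (Sum.inl (Sum.inr w))
    | Sum.inr (Sum.inr z) => Sum.inr (Sum.inr z)
  left_inv := by rintro (i | (l | w) | z) <;> simp
  right_inv := by rintro ((l | i) | w | z) <;> simp

theorem apply_pair_glue (f : GraphParameter) (F G : RootedGraph (L ⊕ Unit))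
    (Z : LabeledGraph 2) :
    f ((F.pair G).glue Z).toFinGraph =
      f (FinGraph.ofEdges _ (((F.map (Sum.map id Sum.inl)).glue
        (G.map (Sum.map id Sum.inr))).glue ((ofLabeled Z).map Sum.inr)).edges) := by
  refine (f.iso_inv _ _ ⟨glueEquiv L (F.U ⊕ G.U) Z.U, ?_⟩)
  simp only [LabeledGraph.toFinGraph, LabeledGraph.glue, pair, FinGraph.ofEdges, ofLabeled,
    RootedGraph.glue, RootedGraph.map, deleteLoops_add, Multiset.map_add, map_map_edges]
  have hl : Function.Injective (Sum.map id Sum.inl : L ⊕ Unit → L ⊕ (Unit ⊕ Unit)) :=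
    Function.injective_id.sumMap Sum.inl_injective
  have hr : Function.Injective (Sum.map id Sum.inr : L ⊕ Unit → L ⊕ (Unit ⊕ Unit)) :=
    Function.injective_id.sumMap Sum.inr_injective
  rw [deleteLoops_map, deleteLoops_map, deleteLoops_map, deleteLoops_eq_self Z.loopless]
  · refine congrArg₂ _ (congrArg₂ _ ?_ ?_) ?_
    · exact map_edges_congr (by rintro ((i | u) | u) <;> rfl) _
    · exact map_edges_congr (by rintro ((i | u) | u) <;> rfl) _
    · exact map_edges_congr (by rintro (i | u) <;> rfl) _
  · exact (Function.injective_id.sumMap Sum.inr_injective).comp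
      ((Sum.inr_injective.sumMap Function.injective_id).comp
        (pairRoots.injective.sumMap Function.injective_id))
  · exact (Function.injective_id.sumMap Sum.inl_injective).comp
      ((Function.injective_id.sumMap Sum.inr_injective).comp
        (hr.sumMap Function.injective_id))
  · exact (Function.injective_id.sumMap Sum.inl_injective).comp
      ((Function.injective_id.sumMap Sum.inl_injective).comp
        (hl.sumMap Function.injective_id))

end RootedGraph

namespace RootedAlgebra

/-- The image of a `2`-labeled quantum graph in the algebra with two roots, rescaled so that
contractors correspond to contractors of the normalised parameter. -/
noncomputable def ofQuantumGraph (f : GraphParameter) :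
    QuantumGraph 2 →ₗ[ℝ] RootedAlgebra (Unit ⊕ Unit) :=
  linExt <| Quotient.lift (fun Z => MonoidAlgebra.single (RootedClass.mk (.ofLabeled Z))
      (f.nodeValue ^ (1 + Fintype.card Z.U))) <| by
    rintro Z Z' h
    rw [show RootedClass.mk (.ofLabeled Z) = RootedClass.mk (.ofLabeled Z') from
      Quotient.sound (RootedGraph.ofLabeled_iso h)]
    obtain ⟨φ, -⟩ := h
    rw [Fintype.card_congr φ]

theorem ofQuantumGraph_single (f : GraphParameter) (Z : LabeledGraph 2) (r : ℝ) :
    ofQuantumGraph f (MonoidAlgebra.single (LabeledClass.mk Z) r) =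
      r • MonoidAlgebra.single (RootedClass.mk (.ofLabeled Z))
        (f.nodeValue ^ (1 + Fintype.card Z.U)) :=
  linExt_single _ _ _

variable {L : Type} [Fintype L]

/-- The exponents of the normalising factor: the nodes of the product are those of `F.pair G`, of
which all but one are counted on the left, and the unlabeled nodes of `z`.  The factor in
`ofQuantumGraph` accounts for the rest. -/
theorem value_pair_mul_ofQuantumGraph {f : GraphParameter} (hc : f.nodeValue ≠ 0)
    (F G : RootedGraph (L ⊕ Unit)) (z : QuantumGraph 2) :
    f.nodeValue ^ (1 + Fintype.card L + Fintype.card F.U + Fintype.card G.U) *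
      value f (MonoidAlgebra.single (RootedClass.mk ((F.map (Sum.map id Sum.inl)).glue
        (G.map (Sum.map id Sum.inr)))) 1 * map Sum.inr (ofQuantumGraph f z) :
          RootedAlgebra (L ⊕ (Unit ⊕ Unit))) =
      f.eval (MonoidAlgebra.single (LabeledClass.mk (F.pair G)) 1 * z) := by
  induction z using MonoidAlgebra.induction_linear with
  | zero => simp
  | add z z' hz hz' => simp only [map_add, mul_add, hz, hz']
  | single c r =>
    obtain ⟨Z⟩ := c
    have h := RootedGraph.apply_pair_glue f F G Z
    change _ * value f (_ * map Sum.inr (ofQuantumGraph f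
      (MonoidAlgebra.single (LabeledClass.mk Z) r))) =
      f.eval (_ * MonoidAlgebra.single (LabeledClass.mk Z) r)
    rw [MonoidAlgebra.single_mul_single]
    change _ = f.eval (MonoidAlgebra.single (LabeledClass.mk ((F.pair G).glue Z)) (1 * r))
    rw [GraphParameter.eval_single, h, ofQuantumGraph_single, map_smul, map_single, mul_smul_comm,
      map_smul, MonoidAlgebra.single_mul_single, value_single, one_mul, one_mul, smul_eq_mul]
    rw [RootedClass.map_mk, RootedClass.mk_mul_mk, RootedClass.value_mk, GraphParameter.normalized]
    have hcard : Fintype.card ((L ⊕ (Unit ⊕ Unit)) ⊕ ((F.U ⊕ G.U) ⊕ Z.U)) =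
        (1 + Fintype.card L + Fintype.card F.U + Fintype.card G.U) + (1 + Fintype.card Z.U) := by
      simp only [Fintype.card_sum, Fintype.card_unit]
      ring
    refine Eq.trans (b := f.nodeValue ^
      (1 + Fintype.card L + Fintype.card F.U + Fintype.card G.U) *
      (r * (f.nodeValue ^ (1 + Fintype.card Z.U) * (_ / f.nodeValue ^
        Fintype.card ((L ⊕ (Unit ⊕ Unit)) ⊕ ((F.U ⊕ G.U) ⊕ Z.U)))))) rfl ?_
    rw [hcard, pow_add _ (1 + Fintype.card L + Fintype.card F.U + Fintype.card G.U)]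
    field_simp

/-- The contractor identifies the last roots of two quantum graphs that are glued along all their
other roots.  This is the only kind of contraction that is needed. -/
theorem value_mul_contractor {f : GraphParameter} (hc : f.nodeValue ≠ 0) {z : QuantumGraph 2}
    (hz : f.IsContractor z) (x y : RootedAlgebra (L ⊕ Unit)) :
    value f (map (Sum.map id Sum.inl) x * map (Sum.map id Sum.inr) y *
      map Sum.inr (ofQuantumGraph f z) : RootedAlgebra (L ⊕ (Unit ⊕ Unit))) =
      value f (x * y) := by
  induction x using MonoidAlgebra.induction_linear with
  | zero => simp
  | add x x' hx hx' => simp only [map_add, add_mul, hx, hx']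
  | single c r =>
    induction y using MonoidAlgebra.induction_linear with
    | zero => simp
    | add y y' hy hy' => simp only [map_add, mul_add, add_mul, hy, hy']
    | single d s =>
      obtain ⟨F⟩ := c
      obtain ⟨G⟩ := d
      have h := hz (MonoidAlgebra.single ⟨LabeledClass.mk (F.pair G),
        RootedGraph.pair_labelsIndep F G⟩ 1)
      have h1 : IndepQuantumGraph.incl 2 (MonoidAlgebra.single ⟨LabeledClass.mk (F.pair G),
        RootedGraph.pair_labelsIndep F G⟩ 1) =
          MonoidAlgebra.single (LabeledClass.mk (F.pair G)) 1 := MonoidAlgebra.mapDomain_single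
      have h2 : IndepQuantumGraph.contract (MonoidAlgebra.single ⟨LabeledClass.mk (F.pair G),
        RootedGraph.pair_labelsIndep F G⟩ 1) = MonoidAlgebra.single
          (LabeledClass.mk ((F.pair G).contract (RootedGraph.pair_labelsIndep F G))) 1 :=
        MonoidAlgebra.mapDomain_single
      rw [h1, h2, GraphParameter.eval_single, RootedGraph.apply_contract_pair,
        ← value_pair_mul_ofQuantumGraph hc, one_mul] at h
      change value f (map _ (MonoidAlgebra.single (RootedClass.mk F) r) *
        map _ (MonoidAlgebra.single (RootedClass.mk G) s) * _) =
        value f (MonoidAlgebra.single (RootedClass.mk F) r *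
          MonoidAlgebra.single (RootedClass.mk G) s)
      rw [map_single, map_single, MonoidAlgebra.single_mul_single,
        MonoidAlgebra.single_mul_single, value_single, RootedClass.mk_mul_mk,
        RootedClass.map_mk, RootedClass.map_mk, RootedClass.mk_mul_mk]
      have h3 : ∀ c : RootedClass (L ⊕ (Unit ⊕ Unit)), MonoidAlgebra.single c (r * s) =
          (r * s) • MonoidAlgebra.single c (1 : ℝ) := fun c => by
        rw [MonoidAlgebra.smul_single, smul_eq_mul, mul_one]
      rw [h3, smul_mul_assoc, map_smul, smul_eq_mul]
      congr 1
      rw [RootedClass.value_mk, GraphParameter.normalized, eq_div_iff (pow_ne_zero _ hc), ← h,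
        mul_comm]
      congr 2
      change Fintype.card ((L ⊕ Unit) ⊕ (F.U ⊕ G.U)) = _
      simp only [Fintype.card_sum, Fintype.card_unit]
      ring

end RootedAlgebra

/-! ### Positive functionals on commutative algebras -/

section PositiveFunctional

variable {B : Type*} [CommRing B] [Algebra ℝ B]

/-- The degenerate case of the Cauchy–Schwarz inequality. -/
theorem functional_mul_eq_zero {τ : B →ₗ[ℝ] ℝ} (hpos : ∀ x, 0 ≤ τ (x * x)) {x : B}
    (hx : τ (x * x) = 0) (y : B) : τ (x * y) = 0 := by
  by_contra hne
  have key : ∀ t : ℝ, 0 ≤ τ (y * y) + 2 * t * τ (x * y) := by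
    intro t
    have h := hpos (y + t • x)
    have e : (y + t • x) * (y + t • x) = y * y + (2 * t) • (x * y) + (t * t) • (x * x) := by
      simp only [Algebra.smul_def, map_mul, map_ofNat]
      ring
    rw [e, map_add, map_add, map_smul, map_smul, hx, smul_zero, add_zero, smul_eq_mul] at h
    exact h
  -- This `t` makes the right-hand side of `key` equal to `-1`.
  have h := key (-(τ (y * y) + 1) / (2 * τ (x * y)))
  have e : 2 * (-(τ (y * y) + 1) / (2 * τ (x * y))) * τ (x * y) = -(τ (y * y) + 1) := by
    field_simp
  rw [e] at h
  linarith

/-- The ideal of elements orthogonal to the whole algebra. -/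
def nullIdeal (τ : B →ₗ[ℝ] ℝ) : Ideal B where
  carrier := {x | ∀ y, τ (x * y) = 0}
  add_mem' := fun {x x'} hx hx' y => by rw [add_mul, map_add, hx, hx', add_zero]
  zero_mem' := fun y => by rw [zero_mul, map_zero]
  smul_mem' := fun c x hx y => by
    rw [smul_eq_mul, mul_comm c x, mul_assoc, hx]

theorem mem_nullIdeal {τ : B →ₗ[ℝ] ℝ} (hpos : ∀ x, 0 ≤ τ (x * x)) {x : B} :
    x ∈ nullIdeal τ ↔ τ (x * x) = 0 :=
  ⟨fun h => h x, fun h => functional_mul_eq_zero hpos h⟩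

/-- The functional induced on the quotient by the null ideal. -/
def quotientFunctional (τ : B →ₗ[ℝ] ℝ) : (B ⧸ nullIdeal τ) →ₗ[ℝ] ℝ :=
  Submodule.liftQ ((nullIdeal τ).restrictScalars ℝ) τ fun x hx => by
    simpa using (hx : ∀ y, τ (x * y) = 0) 1

theorem quotientFunctional_mk (τ : B →ₗ[ℝ] ℝ) (x : B) :
    quotientFunctional τ (Ideal.Quotient.mk _ x) = τ x := rfl

theorem quotientFunctional_mul_self_nonneg {τ : B →ₗ[ℝ] ℝ} (hpos : ∀ x, 0 ≤ τ (x * x))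
    (x : B ⧸ nullIdeal τ) : 0 ≤ quotientFunctional τ (x * x) := by
  obtain ⟨x, rfl⟩ := Ideal.Quotient.mk_surjective x
  rw [← map_mul, quotientFunctional_mk]
  exact hpos x

theorem eq_zero_of_quotientFunctional {τ : B →ₗ[ℝ] ℝ} (hpos : ∀ x, 0 ≤ τ (x * x))
    {x : B ⧸ nullIdeal τ} (hx : quotientFunctional τ (x * x) = 0) : x = 0 := by
  obtain ⟨x, rfl⟩ := Ideal.Quotient.mk_surjective x
  rw [← map_mul, quotientFunctional_mk] at hx
  exact Ideal.Quotient.eq_zero_iff_mem.2 ((mem_nullIdeal hpos).2 hx)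

/-- If orthonormal systems have at most `q` elements, then finite-dimensional subspaces of the
quotient by the null ideal have dimension at most `q`, by orthogonalisation of a basis. -/
theorem finrank_le_of_orthonormal {τ : B →ₗ[ℝ] ℝ} (hpos : ∀ x, 0 ≤ τ (x * x)) {q : ℝ}
    (hq : ∀ (n : ℕ) (x : Fin n → B),
      (∀ i j, τ (x i * x j) = if i = j then 1 else 0) → (n : ℝ) ≤ q)
    (W : Submodule ℝ (B ⧸ nullIdeal τ)) [FiniteDimensional ℝ W] :
    (Module.finrank ℝ W : ℝ) ≤ q := by
  let β : LinearMap.BilinForm ℝ W :=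
    LinearMap.mk₂ ℝ (fun v w => quotientFunctional τ ((v : B ⧸ nullIdeal τ) * w))
      (fun _ _ _ => by simp [add_mul]) (fun _ _ _ => by simp)
      (fun _ _ _ => by simp [mul_add]) (fun _ _ _ => by simp)
  have hβ : LinearMap.IsSymm β := ⟨fun v w => by simp [β, mul_comm]⟩
  obtain ⟨v, hv⟩ := LinearMap.BilinForm.exists_orthogonal_basis hβ
  choose x hx using fun i => Ideal.Quotient.mk_surjective (I := nullIdeal τ) (v i : B ⧸ nullIdeal τ)
  have hxx : ∀ i j, τ (x i * x j) = β (v i) (v j) := fun i j => by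
    rw [← quotientFunctional_mk, map_mul, hx, hx]
    rfl
  have hxpos : ∀ i, 0 < τ (x i * x i) := fun i => by
    refine (hpos _).lt_of_ne fun h => v.ne_zero i ?_
    have := Ideal.Quotient.eq_zero_iff_mem.2 ((mem_nullIdeal hpos).2 h.symm)
    rw [hx] at this
    exact Subtype.ext this
  refine hq _ (fun i => (√(τ (x i * x i)))⁻¹ • x i) fun i j => ?_
  rw [smul_mul_smul_comm, map_smul, smul_eq_mul]
  split_ifs with hij
  · subst hij
    rw [← mul_inv, Real.mul_self_sqrt (hpos _), inv_mul_cancel₀ (hxpos i).ne']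
  · rw [hxx i j, show β (v i) (v j) = 0 from hv hij, mul_zero]

theorem finiteDimensional_of_orthonormal {τ : B →ₗ[ℝ] ℝ} (hpos : ∀ x, 0 ≤ τ (x * x)) {q : ℝ}
    (hq : ∀ (n : ℕ) (x : Fin n → B),
      (∀ i j, τ (x i * x j) = if i = j then 1 else 0) → (n : ℝ) ≤ q) :
    FiniteDimensional ℝ (B ⧸ nullIdeal τ) := by
  have h : Module.rank ℝ (B ⧸ nullIdeal τ) ≤ ⌊q⌋₊ := by
    refine rank_le fun s hs => ?_
    have h := finrank_le_of_orthonormal hpos hq (Submodule.span ℝ (s : Set (B ⧸ nullIdeal τ)))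
    rw [finrank_span_finset_eq_card hs] at h
    exact Nat.le_floor h
  exact Module.rank_lt_aleph0_iff.1 (h.trans_lt (Cardinal.natCast_lt_aleph0))

/-- A residue field of the quotient by the null ideal cannot be `ℂ`, since a square root of
`-e`, for an idempotent `e`, would have a negative square norm. -/
theorem nonempty_algEquiv_real {A : Type*} [CommRing A] [Algebra ℝ A] [FiniteDimensional ℝ A]
    [IsArtinianRing A] [IsReduced A] (τ : A →ₗ[ℝ] ℝ) (hpos : ∀ x, 0 ≤ τ (x * x))
    (hdef : ∀ x, τ (x * x) = 0 → x = 0) (m : MaximalSpectrum A) :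
    Nonempty ((A ⧸ m.asIdeal) ≃ₐ[ℝ] ℝ) := by
  classical
  have := m.isMaximal
  let _ : Field (A ⧸ m.asIdeal) := Ideal.Quotient.field m.asIdeal
  have : FiniteDimensional ℝ (A ⧸ m.asIdeal) :=
    inferInstanceAs (FiniteDimensional ℝ (A ⧸ m.asIdeal.restrictScalars ℝ))
  refine (Real.nonempty_algEquiv_or (A ⧸ m.asIdeal)).resolve_right ?_
  rintro ⟨ψ⟩
  let Θ := IsArtinianRing.equivPi A
  set e := Θ.symm (Pi.single m 1) with he
  set j := Θ.symm (Pi.single m (ψ.symm Complex.I)) with hj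
  have hee : e * e = e := by
    rw [he, ← map_mul, ← Pi.single_mul, one_mul]
  have hjj : j * j = -(e * e) := by
    rw [hee, hj, he, ← map_mul, ← map_neg, ← Pi.single_mul, ← map_mul, Complex.I_mul_I, map_neg,
      map_one, Pi.single_neg]
  have h := hpos j
  rw [hjj, map_neg] at h
  have he0 : e = 0 := hdef e (le_antisymm (by linarith) (hpos e))
  have h1 : (Pi.single m 1 : (I : MaximalSpectrum A) → A ⧸ I.asIdeal) = 0 := by
    rw [← Θ.apply_symm_apply (Pi.single m 1), ← he, he0, map_zero]
  exact one_ne_zero (Pi.single_eq_zero_iff.1 h1)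

/-- Modulo its null ideal, a positive functional whose orthonormal systems are bounded in size
lives on an algebra `ℝ^d`. -/
theorem exists_algHom_pi {τ : B →ₗ[ℝ] ℝ} (hpos : ∀ x, 0 ≤ τ (x * x)) {q : ℝ}
    (hq : ∀ (n : ℕ) (x : Fin n → B),
      (∀ i j, τ (x i * x j) = if i = j then 1 else 0) → (n : ℝ) ≤ q) :
    ∃ (d : ℕ) (Φ : B →ₐ[ℝ] (Fin d → ℝ)), (d : ℝ) ≤ q ∧ Function.Surjective Φ ∧
      ∀ x, Φ x = 0 ↔ τ (x * x) = 0 := by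
  have hfin := finiteDimensional_of_orthonormal hpos hq
  have hpos' := quotientFunctional_mul_self_nonneg hpos
  have hdef : ∀ x : B ⧸ nullIdeal τ, quotientFunctional τ (x * x) = 0 → x = 0 :=
    fun x => eq_zero_of_quotientFunctional hpos
  have hart : IsArtinianRing (B ⧸ nullIdeal τ) := IsArtinianRing.of_finite ℝ _
  have hred : IsReduced (B ⧸ nullIdeal τ) := by
    refine (isReduced_iff_pow_one_lt 2 one_lt_two).2 fun x hx => hdef x ?_
    rw [← pow_two, hx, map_zero]
  have hψ := nonempty_algEquiv_real (quotientFunctional τ) hpos' hdef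
  have := Fintype.ofFinite (MaximalSpectrum (B ⧸ nullIdeal τ))
  let Θ : (B ⧸ nullIdeal τ) ≃ₐ[ℝ] (Fin (Fintype.card (MaximalSpectrum (B ⧸ nullIdeal τ))) → ℝ) :=
    (((IsArtinianRing.equivPi (B ⧸ nullIdeal τ)).restrictScalars ℝ).trans
      (AlgEquiv.piCongrRight fun m => (hψ m).some)).trans (AlgEquiv.piCongrLeft ℝ (fun _ => ℝ) (Fintype.equivFin _))
  refine ⟨_, Θ.toAlgHom.comp (Ideal.Quotient.mkₐ ℝ (nullIdeal τ)), ?_, ?_, fun x => ?_⟩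
  · have h := finrank_le_of_orthonormal hpos hq ⊤
    rw [finrank_top, Θ.toLinearEquiv.finrank_eq, Module.finrank_fin_fun] at h
    exact h
  · exact Θ.surjective.comp (Ideal.Quotient.mkₐ_surjective ℝ _)
  · rw [← mem_nullIdeal hpos, ← Ideal.Quotient.eq_zero_iff_mem]
    exact map_eq_zero_iff Θ Θ.injective

end PositiveFunctional

/-- In `ℝ^{d'}` with `d' ≤ d`, each member of a system of `d` nonzero vectors with pairwise
disjoint supports is supported on a single coordinate. -/
theorem exists_smul_of_disjoint_supports {d d' : ℕ} (hd : d' ≤ d) (E : Fin d → Fin d' → ℝ)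
    (hne : ∀ j, E j ≠ 0) (hmul : ∀ j k, j ≠ k → E j * E k = 0) (w : Fin d' → ℝ) (j : Fin d) :
    ∃ c : ℝ, w * E j = c • E j := by
  -- `κ` picks a coordinate in each support; it is a bijection because the supports are disjoint.
  choose κ hκ using fun j => Function.ne_iff.1 (hne j)
  have hinj : Function.Injective κ := by
    intro j k hjk
    by_contra h
    have h' := congrFun (hmul j k h) (κ j)
    rw [Pi.mul_apply, Pi.zero_apply, mul_eq_zero] at h'
    exact h'.elim (hκ j) (hjk ▸ hκ k)
  have hsurj : Function.Surjective κ :=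
    ((Fintype.bijective_iff_injective_and_card κ).2
      ⟨hinj, le_antisymm (Fintype.card_le_of_injective κ hinj) (by simpa using hd)⟩).2
  refine ⟨w (κ j), funext fun i => ?_⟩
  obtain ⟨k, rfl⟩ := hsurj i
  by_cases hjk : j = k
  · subst hjk; rfl
  · have h' := congrFun (hmul j k hjk) (κ k)
    rw [Pi.mul_apply, Pi.zero_apply, mul_eq_zero] at h'
    rw [Pi.mul_apply, Pi.smul_apply, h'.resolve_right (hκ k), mul_zero, smul_zero]

/-! ### Conditioning on a minimal idempotent of the roots -/

/-- The parameters whose normalisation is a positive functional on every algebra of rooted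
quantum graphs. -/
structure GraphParameter.Normalizable (f : GraphParameter) : Prop where
  nonzero : ∃ F : FinGraph, f F ≠ 0
  multiplicative : f.Multiplicative
  reflectionPositive : f.ReflectionPositive
  nodeValue_pos : 0 < f.nodeValue

namespace RootedAlgebra

/-- The functional `x ↦ f(px)`, where `p` is a quantum graph rooted at `L` and `x` has further
roots. -/
noncomputable def condValue (f : GraphParameter) {L T : Type} [Fintype L] [Fintype T]
    (p : RootedAlgebra L) : RootedAlgebra (L ⊕ T) →ₗ[ℝ] ℝ :=
  value f ∘ₗ LinearMap.mulLeft ℝ (map Sum.inl p)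

theorem condValue_apply (f : GraphParameter) {L T : Type} [Fintype L] [Fintype T]
    (p : RootedAlgebra L) (x : RootedAlgebra (L ⊕ T)) :
    condValue f p x = value f (map Sum.inl p * x) := rfl

/-- A quantum graph `p` rooted at `L` is a state if `x ↦ f(px)` is a positive normalised functional
and is multiplicative on the quantum graphs rooted at `L`.  Positive multiples of minimal idempotents
modulo the null ideal, normalised to have value `1`, are states. -/
structure IsState (f : GraphParameter) {L : Type} [Fintype L] (p : RootedAlgebra L) : Prop where
  value_eq_one : value f p = 1
  nonneg : ∀ (T : Type) [Fintype T] (x : RootedAlgebra (L ⊕ T)), 0 ≤ condValue f p (x * x)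
  mul : ∀ x y : RootedAlgebra L, value f (p * (x * y)) = value f (p * x) * value f (p * y)

section

variable {f : GraphParameter} {L T T' V : Type} [Fintype L] [Fintype T] [Fintype T'] [Fintype V]
  {p : RootedAlgebra L}

theorem condValue_eq_value_unroot (p : RootedAlgebra L) (x : RootedAlgebra (L ⊕ T)) :
    condValue f p x = value f (p * unroot x) := by
  rw [condValue_apply, ← value_unroot, unroot_map_inl_mul]

/-- Given the state of the common roots, quantum graphs with disjoint further roots are
independent. -/
theorem IsState.condValue_mul (hp : IsState f p) (x : RootedAlgebra (L ⊕ T))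
    (y : RootedAlgebra (L ⊕ T')) :
    condValue f p (map (Sum.map id Sum.inl) x * map (Sum.map id Sum.inr) y :
      RootedAlgebra (L ⊕ (T ⊕ T'))) = condValue f p x * condValue f p y := by
  rw [condValue_eq_value_unroot, condValue_eq_value_unroot, condValue_eq_value_unroot, unroot_mul,
    hp.mul]

theorem condValue_map (hf : f.Normalizable) {φ : T → T'} (hφ : Function.Injective φ)
    (x : RootedAlgebra (L ⊕ T)) :
    condValue f p (map (Sum.map id φ) x) = condValue f p x := by
  rw [condValue_apply, condValue_apply, ← value_map hf.nonzero hf.multiplicative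
    hf.nodeValue_pos.ne' (Function.injective_id.sumMap hφ) (map Sum.inl p * x), map_mul (map _), map_map]
  rfl

theorem IsState.condValue_map_mul (hf : f.Normalizable) (hp : IsState f p) {φ : T → V} {ψ : T' → V}
    (h : Function.Injective (Sum.elim φ ψ)) (x : RootedAlgebra (L ⊕ T))
    (y : RootedAlgebra (L ⊕ T')) :
    condValue f p (map (Sum.map id φ) x * map (Sum.map id ψ) y) =
      condValue f p x * condValue f p y := by
  rw [← hp.condValue_mul, ← condValue_map hf h, map_mul (map _), map_map, map_map, Sum.map_comp_map,
    Sum.map_comp_map]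
  rfl

theorem IsState.condValue_map_inr (hf : f.Normalizable) (hp : IsState f p) (y : RootedAlgebra T) :
    condValue f p (map Sum.inr y) = value f y := by
  rw [condValue_apply, value_map_inl_mul_map_inr hf.multiplicative, hp.value_eq_one, one_mul]

theorem IsState.condValue_one (hf : f.Normalizable) (hp : IsState f p) :
    condValue f p (1 : RootedAlgebra (L ⊕ T)) = 1 := by
  rw [← map_one (map Sum.inr), hp.condValue_map_inr hf,
    value_one hf.nonzero hf.multiplicative hf.nodeValue_pos.ne']

/-- Null elements stay null when they are mapped to a larger set of roots. -/
theorem IsState.condValue_map_mul_eq_zero (hf : f.Normalizable) (hp : IsState f p) {φ : T → T'}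
    (hφ : Function.Injective φ) {x : RootedAlgebra (L ⊕ T)} (hx : condValue f p (x * x) = 0)
    (y : RootedAlgebra (L ⊕ T')) : condValue f p (map (Sum.map id φ) x * y) = 0 := by
  refine functional_mul_eq_zero (hp.nonneg T') ?_ y
  rw [← map_mul, condValue_map hf hφ, hx]

theorem isState_one (hf : f.Normalizable) : IsState f (1 : RootedAlgebra Empty) where
  value_eq_one := value_one hf.nonzero hf.multiplicative hf.nodeValue_pos.ne'
  nonneg := fun T _ x => by
    rw [condValue_apply, map_one, one_mul]
    exact value_mul_self_nonneg hf.nonzero hf.multiplicative hf.reflectionPositive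
      hf.nodeValue_pos x
  mul := fun x y => by
    rw [one_mul, one_mul, one_mul, ← value_map_inl_mul_map_inr hf.multiplicative,
      ← value_map hf.nonzero hf.multiplicative hf.nodeValue_pos.ne'
        (Sum.inl_injective (α := Empty) (β := Empty)), map_mul,
      Subsingleton.elim (Sum.inr : Empty → Empty ⊕ Empty) Sum.inl]

/-- Bessel's inequality: if `x₁, …, xₙ` are orthonormal with one further root, then the elements
`xᵢ ⊗ xᵢ` with two further roots are orthonormal and the contractor has inner product `1` with each
of them. -/
theorem IsState.card_le_of_orthonormal (hf : f.Normalizable) {z : QuantumGraph 2}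
    (hz : f.IsContractor z) (hp : IsState f p) (n : ℕ) (x : Fin n → RootedAlgebra (L ⊕ Unit))
    (hx : ∀ i j, condValue f p (x i * x j) = if i = j then 1 else 0) :
    (n : ℝ) ≤ value f (ofQuantumGraph f z * ofQuantumGraph f z) := by
  set Z : RootedAlgebra (L ⊕ (Unit ⊕ Unit)) := map Sum.inr (ofQuantumGraph f z) with hZ
  set w : RootedAlgebra (L ⊕ (Unit ⊕ Unit)) :=
    ∑ i, map (Sum.map id Sum.inl) (x i) * map (Sum.map id Sum.inr) (x i) with hw
  have hZZ : condValue f p (Z * Z) = value f (ofQuantumGraph f z * ofQuantumGraph f z) := by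
    rw [hZ, ← map_mul, hp.condValue_map_inr hf]
  have hwZ : condValue f p (w * Z) = n := by
    have h : ∀ i, condValue f p
        (map (Sum.map id Sum.inl) (x i) * map (Sum.map id Sum.inr) (x i) * Z) = 1 := by
      intro i
      have h' := value_mul_contractor hf.nodeValue_pos.ne' hz (map Sum.inl p * x i) (x i)
      rw [map_mul (map _), map_map, mul_assoc (map Sum.inl p) (x i), ← condValue_apply, hx,
        if_pos rfl] at h'
      rw [condValue_apply, ← h', ← mul_assoc, ← mul_assoc]
      rfl
    rw [hw, Finset.sum_mul, map_sum, Finset.sum_congr rfl fun i _ => h i]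
    simp
  have hww : condValue f p (w * w) = n := by
    have h : ∀ i j, condValue f p
        (map (Sum.map id Sum.inl) (x i) * map (Sum.map id Sum.inr) (x i) *
          (map (Sum.map id Sum.inl) (x j) * map (Sum.map id Sum.inr) (x j)) :
          RootedAlgebra (L ⊕ (Unit ⊕ Unit))) = if i = j then 1 else 0 := by
      intro i j
      rw [mul_mul_mul_comm, ← map_mul, ← map_mul, hp.condValue_mul, hx]
      split_ifs <;> simp
    simp only [hw, Finset.sum_mul_sum, map_sum, h]
    simp
  -- The square norm of `w - Z` is `n - 2n + ‖Z‖²`.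
  have h := hp.nonneg _ (w - Z)
  have e : (w - Z) * (w - Z) = w * w - (w * Z + w * Z) + Z * Z := by ring
  rw [e, map_add, map_sub, map_add, hww, hwZ, hZZ] at h
  linarith

/-- A presentation of the algebra of quantum graphs with one root more than a state `p`, modulo the
null ideal of `p`, as `ℝ^d`. -/
structure IsSpectrum (f : GraphParameter) (p : RootedAlgebra L) {d : ℕ}
    (Φ : RootedAlgebra (L ⊕ Unit) →ₐ[ℝ] (Fin d → ℝ)) : Prop where
  surjective : Function.Surjective Φ
  apply_eq_zero_iff : ∀ x, Φ x = 0 ↔ condValue f p (x * x) = 0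

theorem IsState.exists_isSpectrum (hf : f.Normalizable) {z : QuantumGraph 2}
    (hz : f.IsContractor z) (hp : IsState f p) :
    ∃ (d : ℕ) (Φ : RootedAlgebra (L ⊕ Unit) →ₐ[ℝ] (Fin d → ℝ)),
      (d : ℝ) ≤ value f (ofQuantumGraph f z * ofQuantumGraph f z) ∧ IsSpectrum f p Φ := by
  obtain ⟨d, Φ, hd, hs, hk⟩ := exists_algHom_pi (hp.nonneg Unit)
    (hp.card_le_of_orthonormal hf hz)
  exact ⟨d, Φ, hd, hs, hk⟩

section spectrum

variable {d : ℕ} {Φ : RootedAlgebra (L ⊕ Unit) →ₐ[ℝ] (Fin d → ℝ)}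

theorem IsSpectrum.condValue_sub_mul_self (hΦ : IsSpectrum f p Φ) {x y : RootedAlgebra (L ⊕ Unit)}
    (h : Φ x = Φ y) : condValue f p ((x - y) * (x - y)) = 0 := by
  rw [← hΦ.apply_eq_zero_iff, map_sub, h, sub_self]

theorem IsSpectrum.condValue_mul_congr (hp : IsState f p) (hΦ : IsSpectrum f p Φ)
    {x y : RootedAlgebra (L ⊕ Unit)} (h : Φ x = Φ y) (w : RootedAlgebra (L ⊕ Unit)) :
    condValue f p (x * w) = condValue f p (y * w) := by
  have := functional_mul_eq_zero (hp.nonneg Unit) (hΦ.condValue_sub_mul_self h) w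
  rwa [sub_mul, map_sub, sub_eq_zero] at this

variable {e : RootedAlgebra (L ⊕ Unit)} {i : Fin d}

theorem IsSpectrum.condValue_idempotent_pos (hp : IsState f p) (hΦ : IsSpectrum f p Φ)
    (he : Φ e = Pi.single i 1) : 0 < condValue f p e := by
  have h : Φ (e * e) = Φ e := by rw [map_mul, he, ← Pi.single_mul, one_mul]
  have h' := hΦ.condValue_mul_congr hp h 1
  rw [mul_one, mul_one] at h'
  rw [← h']
  refine (hp.nonneg Unit e).lt_of_ne fun h0 => ?_
  have h1 := (hΦ.apply_eq_zero_iff e).2 h0.symm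
  rw [he] at h1
  exact one_ne_zero (Pi.single_eq_zero_iff.1 h1)

theorem IsSpectrum.condValue_idempotent_mul (hp : IsState f p) (hΦ : IsSpectrum f p Φ)
    (he : Φ e = Pi.single i 1) (w : RootedAlgebra (L ⊕ Unit)) :
    condValue f p (e * w) = Φ w i * condValue f p e := by
  have h : Φ (e * w) = Φ (Φ w i • e) := by
    rw [map_mul, map_smul, he]
    ext j
    by_cases hj : j = i
    · subst hj; simp
    · simp [hj]
  have h' := hΦ.condValue_mul_congr hp h 1
  rwa [mul_one, mul_one, map_smul, smul_eq_mul] at h'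

/-- Replacing an idempotent by its square, inside an algebra with more roots. -/
theorem IsSpectrum.condValue_map_idempotent_sq_mul (hf : f.Normalizable) (hp : IsState f p)
    (hΦ : IsSpectrum f p Φ) (he : Φ e = Pi.single i 1) {φ : Unit → T} (hφ : Function.Injective φ)
    (y : RootedAlgebra (L ⊕ T)) :
    condValue f p (map (Sum.map id φ) e * map (Sum.map id φ) e * y) =
      condValue f p (map (Sum.map id φ) e * y) := by
  have h : Φ (e * e) = Φ e := by rw [map_mul, he, ← Pi.single_mul, one_mul]
  have h' := hp.condValue_map_mul_eq_zero hf hφ (hΦ.condValue_sub_mul_self h) y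
  rwa [map_sub, map_mul (map _), sub_mul, map_sub, sub_eq_zero] at h'

/-- The state refined by an idempotent with one more root. -/
noncomputable def refine (f : GraphParameter) (p : RootedAlgebra L)
    (e : RootedAlgebra (L ⊕ Unit)) : RootedAlgebra (L ⊕ Unit) :=
  (condValue f p e)⁻¹ • (map Sum.inl p * e)

theorem condValue_refine (hf : f.Normalizable) (p : RootedAlgebra L)
    (e : RootedAlgebra (L ⊕ Unit)) (x : RootedAlgebra ((L ⊕ Unit) ⊕ T)) :
    condValue f (refine f p e) x = (condValue f p e)⁻¹ *
      condValue f p (map (Sum.map id Sum.inl) e * map (Equiv.sumAssoc L Unit T) x) := by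
  rw [condValue_apply, refine, map_smul, smul_mul_assoc, map_smul, smul_eq_mul, condValue_apply
    (T := Unit ⊕ T), ← value_map hf.nonzero hf.multiplicative hf.nodeValue_pos.ne'
      (Equiv.sumAssoc L Unit T).injective, map_mul (map _), map_mul (map _), map_mul (map _), map_map, map_map, map_map,
      mul_assoc]
  rfl

theorem IsSpectrum.isState_refine (hf : f.Normalizable) (hp : IsState f p)
    (hΦ : IsSpectrum f p Φ) (he : Φ e = Pi.single i 1) : IsState f (refine f p e) := by
  have hα := hΦ.condValue_idempotent_pos hp he
  have hval : ∀ x, value f (refine f p e * x) = Φ x i := fun x => by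
    rw [refine, smul_mul_assoc, map_smul, mul_assoc, ← condValue_apply,
      hΦ.condValue_idempotent_mul hp he, smul_eq_mul, mul_comm (Φ x i),
      inv_mul_cancel_left₀ hα.ne']
  refine ⟨?_, fun T _ x => ?_, fun x y => ?_⟩
  · rw [refine, map_smul, ← condValue_apply, smul_eq_mul, inv_mul_cancel₀ hα.ne']
  · rw [condValue_refine hf, map_mul (map _), ← hΦ.condValue_map_idempotent_sq_mul hf hp he
      Sum.inl_injective, mul_mul_mul_comm]
    exact mul_nonneg (inv_nonneg.2 hα.le) (hp.nonneg _ _)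
  · rw [hval, hval, hval, map_mul, Pi.mul_apply]

/-- A new root is independent of the refined state. -/
theorem IsSpectrum.condValue_refine_map (hf : f.Normalizable) (hp : IsState f p)
    (hΦ : IsSpectrum f p Φ) (he : Φ e = Pi.single i 1) (x : RootedAlgebra (L ⊕ Unit)) :
    condValue f (refine f p e) (map (Sum.map Sum.inl id) x : RootedAlgebra ((L ⊕ Unit) ⊕ Unit)) =
      condValue f p x := by
  have h : (Equiv.sumAssoc L Unit Unit) ∘ Sum.map Sum.inl id = Sum.map id Sum.inr := by
    funext a
    obtain a | a := a <;> rfl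
  rw [condValue_refine hf, map_map, h, hp.condValue_mul,
    inv_mul_cancel_left₀ (hΦ.condValue_idempotent_pos hp he).ne']

/-- Suppose that refining the state `p` does not enlarge the dimension `d` of the spectrum.  Then
the idempotents of two new roots remain minimal in the algebra with both roots. -/
theorem IsSpectrum.exists_smul_null (hf : f.Normalizable) (hp : IsState f p)
    (hΦ : IsSpectrum f p Φ) {e : Fin d → RootedAlgebra (L ⊕ Unit)}
    (he : ∀ i, Φ (e i) = Pi.single i 1) (i : Fin d)
    {d' : ℕ} {Φ' : RootedAlgebra ((L ⊕ Unit) ⊕ Unit) →ₐ[ℝ] (Fin d' → ℝ)}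
    (hΦ' : IsSpectrum f (refine f p (e i)) Φ') (hd : d' ≤ d)
    (x : RootedAlgebra (L ⊕ (Unit ⊕ Unit))) (j : Fin d) :
    ∃ c : ℝ, condValue f p
      ((x * (map (Sum.map id Sum.inl) (e i) * map (Sum.map id Sum.inr) (e j)) -
        c • (map (Sum.map id Sum.inl) (e i) * map (Sum.map id Sum.inr) (e j))) *
       (x * (map (Sum.map id Sum.inl) (e i) * map (Sum.map id Sum.inr) (e j)) -
        c • (map (Sum.map id Sum.inl) (e i) * map (Sum.map id Sum.inr) (e j)))) = 0 := by
  have hα := hΦ.condValue_idempotent_pos hp (he i)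
  have hE : ∀ y : RootedAlgebra (L ⊕ Unit),
      Φ' (map (Sum.map Sum.inl id) y) = 0 ↔ Φ y = 0 := fun y => by
    rw [hΦ'.apply_eq_zero_iff, hΦ.apply_eq_zero_iff, ← map_mul, hΦ.condValue_refine_map hf hp (he i)]
  -- The images of the `e j` are `d` nonzero orthogonal idempotents in an algebra of dimension at
  -- most `d`.
  obtain ⟨c, hc⟩ := exists_smul_of_disjoint_supports hd
    (fun j => Φ' (map (Sum.map Sum.inl id) (e j)))
    (fun j => by
      rw [Ne, hE, he]
      exact fun h => one_ne_zero (Pi.single_eq_zero_iff.1 h))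
    (fun j k hjk => by
      rw [← map_mul, ← map_mul, hE, map_mul, he, he]
      funext l
      by_cases hl : l = j
      · subst hl; simp [hjk]
      · simp [hl])
    (Φ' (map (Equiv.sumAssoc L Unit Unit).symm x)) j
  refine ⟨c, ?_⟩
  set u : RootedAlgebra (L ⊕ (Unit ⊕ Unit)) := map (Sum.map id Sum.inl) (e i) with hu
  set v : RootedAlgebra (L ⊕ (Unit ⊕ Unit)) := map (Sum.map id Sum.inr) (e j) with hv
  rw [← map_mul, ← map_smul, ← sub_eq_zero, ← map_sub, hΦ'.apply_eq_zero_iff, condValue_refine hf,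
    mul_eq_zero, or_iff_right (inv_ne_zero hα.ne')] at hc
  have hx : map (Equiv.sumAssoc L Unit Unit) (map (Equiv.sumAssoc L Unit Unit).symm x) = x := by
    rw [map_map, Equiv.self_comp_symm]
    exact map_id x
  have hv' : map (Equiv.sumAssoc L Unit Unit) (map (Sum.map Sum.inl id) (e j)) = v := by
    rw [map_map, hv]
    congr 2
    funext a
    obtain a | a := a <;> rfl
  rw [map_mul (map _), map_sub, map_mul (map _), map_smul, hx, hv', ← hu,
    ← hΦ.condValue_map_idempotent_sq_mul hf hp (he i) Sum.inl_injective] at hc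
  rw [← hc]
  congr 1
  simp only [Algebra.smul_def]
  ring

end spectrum

end

/-- A state with a spectrum of maximal dimension carries a complete system of idempotents that
remain minimal in the algebra with two further roots. -/
theorem exists_rigid_state {f : GraphParameter} (hf : f.Normalizable) {z : QuantumGraph 2}
    (hz : f.IsContractor z) :
    ∃ (L : Type) (_ : Fintype L) (p : RootedAlgebra L) (d : ℕ)
      (e : Fin d → RootedAlgebra (L ⊕ Unit)), IsState f p ∧ (∀ i, 0 < condValue f p (e i)) ∧
      condValue f p ((1 - ∑ i, e i) * (1 - ∑ i, e i)) = 0 ∧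
      ∀ (x : RootedAlgebra (L ⊕ (Unit ⊕ Unit))) (i j : Fin d), ∃ c : ℝ, condValue f p
        ((x * (map (Sum.map id Sum.inl) (e i) * map (Sum.map id Sum.inr) (e j)) -
          c • (map (Sum.map id Sum.inl) (e i) * map (Sum.map id Sum.inr) (e j))) *
         (x * (map (Sum.map id Sum.inl) (e i) * map (Sum.map id Sum.inr) (e j)) -
          c • (map (Sum.map id Sum.inl) (e i) * map (Sum.map id Sum.inr) (e j)))) = 0 := by
  let S : Set ℕ := {d | ∃ (L : Type) (_ : Fintype L) (p : RootedAlgebra L)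
    (Φ : RootedAlgebra (L ⊕ Unit) →ₐ[ℝ] (Fin d → ℝ)), IsState f p ∧ IsSpectrum f p Φ ∧
      (d : ℝ) ≤ value f (ofQuantumGraph f z * ofQuantumGraph f z)}
  have hbdd : BddAbove S := by
    refine ⟨⌊value f (ofQuantumGraph f z * ofQuantumGraph f z)⌋₊, ?_⟩
    rintro d ⟨-, -, -, -, -, -, hd⟩
    exact Nat.le_floor hd
  have hne : S.Nonempty := by
    obtain ⟨d, Φ, hd, hΦ⟩ := (isState_one hf).exists_isSpectrum hf hz
    exact ⟨d, Empty, inferInstance, 1, Φ, isState_one hf, hΦ, hd⟩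
  obtain ⟨L, hL, p, Φ, hp, hΦ, -⟩ := Nat.sSup_mem hne hbdd
  choose e he using fun i => hΦ.surjective (Pi.single i 1)
  refine ⟨L, hL, p, _, e, hp, fun i => hΦ.condValue_idempotent_pos hp (he i), ?_, fun x i j => ?_⟩
  · rw [← hΦ.apply_eq_zero_iff, map_sub, map_one, map_sum, sub_eq_zero]
    funext k
    simp [he, Finset.sum_apply, Pi.single_apply]
  · have hq := hΦ.isState_refine hf hp (he i)
    obtain ⟨d', Φ', hd', hΦ'⟩ := hq.exists_isSpectrum hf hz
    exact hΦ.exists_smul_null hf hp he i hΦ'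
      (le_csSup hbdd ⟨_, _, _, Φ', hq, hΦ', hd'⟩) x j

end RootedAlgebra

/-! ### The weighted graph of a rigid state -/

namespace RootedAlgebra

/-- The quantum graph rooted at `L ⊕ V` without unrooted nodes whose edges are a given multiset of
pairs in `V`. -/
noncomputable def edgeElement (L : Type) {V : Type} (E : Multiset (Sym2 V)) :
    RootedAlgebra (L ⊕ V) :=
  map Sum.inr (MonoidAlgebra.single (RootedClass.ofEdges E) 1)

theorem edgeElement_zero (L : Type) {V : Type} : edgeElement L (0 : Multiset (Sym2 V)) = 1 :=
  map_one (map Sum.inr)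

theorem edgeElement_cons (L : Type) {V : Type} (e : Sym2 V) (E : Multiset (Sym2 V)) :
    edgeElement L (e ::ₘ E) = edgeElement L {e} * edgeElement L E := by
  rw [edgeElement, edgeElement, edgeElement, ← map_mul, MonoidAlgebra.single_mul_single, one_mul,
    ← RootedClass.ofEdges_add, Multiset.singleton_add]

theorem map_edgeElement (L : Type) {V W : Type} (φ : V → W) (E : Multiset (Sym2 V)) :
    map (Sum.map id φ) (edgeElement L E) = edgeElement L (E.map (Sym2.map φ)) := by
  rw [edgeElement, edgeElement, map_map, ← RootedClass.map_ofEdges, ← map_single, map_map]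
  rfl

section

variable {f : GraphParameter} {L : Type} [Fintype L] {p : RootedAlgebra L}

/-- Further roots are mutually independent given the state of the common roots. -/
theorem IsState.condValue_prod_fin (hf : f.Normalizable) (hp : IsState f p) (n : ℕ)
    (x : Fin n → RootedAlgebra (L ⊕ Unit)) :
    condValue f p (∏ v, map (Sum.map id fun _ => v) (x v) : RootedAlgebra (L ⊕ Fin n)) =
      ∏ v, condValue f p (x v) := by
  induction n with
  | zero => simp [hp.condValue_one hf]
  | succ n ih =>
    have h : (∏ v : Fin n, map (Sum.map id fun _ => v.succ) (x v.succ) :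
        RootedAlgebra (L ⊕ Fin (n + 1))) =
        map (Sum.map id Fin.succ) (∏ v : Fin n, map (Sum.map id fun _ => v) (x v.succ)) := by
      rw [map_prod]
      refine Finset.prod_congr rfl fun v _ => ?_
      rw [map_map, Sum.map_comp_map]
      rfl
    rw [Fin.prod_univ_succ, Fin.prod_univ_succ, h, hp.condValue_map_mul hf, ih]
    rintro (a | a) (b | b) hab
    · rfl
    · exact absurd hab (Fin.succ_ne_zero b).symm
    · exact absurd hab (Fin.succ_ne_zero a)
    · exact congrArg Sum.inr (Fin.succ_injective n hab)

theorem IsState.condValue_prod (hf : f.Normalizable) (hp : IsState f p) {V : Type} [Fintype V]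
    (x : V → RootedAlgebra (L ⊕ Unit)) :
    condValue f p (∏ v, map (Sum.map id fun _ => v) (x v) : RootedAlgebra (L ⊕ V)) =
      ∏ v, condValue f p (x v) := by
  let σ := Fintype.equivFin V
  rw [← condValue_map hf σ.injective, map_prod, ← σ.symm.prod_comp,
    ← σ.symm.prod_comp (fun v => condValue f p (x v)), ← hp.condValue_prod_fin hf]
  congr 1
  refine Finset.prod_congr rfl fun v _ => ?_
  rw [map_map, Sum.map_comp_map]
  congr 3
  funext _
  exact σ.apply_symm_apply v

theorem IsState.condValue_edgeElement (hf : f.Normalizable) (hp : IsState f p) {V : Type}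
    [Fintype V] (E : Multiset (Sym2 V)) :
    condValue f p (edgeElement L E) = f.normalized V E := by
  rw [edgeElement, hp.condValue_map_inr hf, value_single, one_mul]
  exact GraphParameter.normalized_map hf.nonzero hf.multiplicative hf.nodeValue_pos.ne'
    Sum.inl_injective E

variable {d : ℕ} {e : Fin d → RootedAlgebra (L ⊕ Unit)}

/-- The edgeweights are symmetric because a transposition of the two roots preserves the edge. -/
theorem IsState.edgeWeight_symm (hf : f.Normalizable) (hp : IsState f p)
    (hpos : ∀ i, 0 < condValue f p (e i)) {β : Fin d → Fin d → ℝ}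
    (hβ : ∀ (i j : Fin d) (y : RootedAlgebra (L ⊕ (Unit ⊕ Unit))), condValue f p
      ((edgeElement L {s(Sum.inl (), Sum.inr ())} *
          (map (Sum.map id Sum.inl) (e i) * map (Sum.map id Sum.inr) (e j)) -
        β i j • (map (Sum.map id Sum.inl) (e i) * map (Sum.map id Sum.inr) (e j))) * y) = 0)
    (i j : Fin d) : β i j = β j i := by
  have h : ∀ i j, condValue f p (edgeElement L {s(Sum.inl (), Sum.inr ())} *
      (map (Sum.map id Sum.inl) (e i) * map (Sum.map id Sum.inr) (e j)) :
        RootedAlgebra (L ⊕ (Unit ⊕ Unit))) =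
      β i j * (condValue f p (e i) * condValue f p (e j)) := fun i j => by
    have h' := hβ i j 1
    rwa [mul_one, map_sub, sub_eq_zero, map_smul, hp.condValue_mul, smul_eq_mul] at h'
  have hsymm : condValue f p (edgeElement L {s(Sum.inl (), Sum.inr ())} *
      (map (Sum.map id Sum.inl) (e i) * map (Sum.map id Sum.inr) (e j)) :
        RootedAlgebra (L ⊕ (Unit ⊕ Unit))) =
      condValue f p (edgeElement L {s(Sum.inl (), Sum.inr ())} *
      (map (Sum.map id Sum.inl) (e j) * map (Sum.map id Sum.inr) (e i)) :
        RootedAlgebra (L ⊕ (Unit ⊕ Unit))) := by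
    rw [← condValue_map hf (Equiv.sumComm Unit Unit).injective, map_mul (map _),
      map_mul (map _), map_edgeElement, map_map, map_map, Sum.map_comp_map, Sum.map_comp_map,
      Multiset.map_singleton, Sym2.map_mk, mul_comm (map _ (e i)), Sym2.eq_swap]
    rfl
  rw [h, h, mul_comm (condValue f p (e j))] at hsymm
  exact mul_right_cancel₀ (mul_pos (hpos i) (hpos j)).ne' hsymm

/-- The weighted graph of a rigid state, its nodeweights multiplied by `c`. -/
noncomputable def spectralGraph (α : Fin d → ℝ) (hα : ∀ i, 0 < α i) (c : ℝ) (hc : 0 < c)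
    (β : Fin d → Fin d → ℝ) (hβ : ∀ i j, β i j = β j i) : WeightedGraph where
  V := Fin d
  α := fun i => c * α i
  α_pos := fun i => mul_pos hc (hα i)
  β := β
  β_symm := hβ

/-- The normalised parameter is a homomorphism function: expand the unit as the sum of the products
of idempotents of the nodes; on each product, the edges act as scalars. -/
theorem IsState.normalized_eq_sum (hf : f.Normalizable) (hp : IsState f p)
    (hone : condValue f p ((1 - ∑ i, e i) * (1 - ∑ i, e i)) = 0) {β : Fin d → Fin d → ℝ}
    (hsymm : ∀ i j, β i j = β j i)
    (hβ : ∀ i j : Fin d, condValue f p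
      ((edgeElement L {s(Sum.inl (), Sum.inr ())} *
          (map (Sum.map id Sum.inl) (e i) * map (Sum.map id Sum.inr) (e j)) -
        β i j • (map (Sum.map id Sum.inl) (e i) * map (Sum.map id Sum.inr) (e j))) *
       (edgeElement L {s(Sum.inl (), Sum.inr ())} *
          (map (Sum.map id Sum.inl) (e i) * map (Sum.map id Sum.inr) (e j)) -
        β i j • (map (Sum.map id Sum.inl) (e i) * map (Sum.map id Sum.inr) (e j)) :
        RootedAlgebra (L ⊕ (Unit ⊕ Unit)))) = 0)
    {V : Type} [Fintype V] [DecidableEq V] {E : Multiset (Sym2 V)} (hE : ∀ a ∈ E, ¬ a.IsDiag) :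
    f.normalized V E = ∑ ψ : V → Fin d, (∏ v, condValue f p (e (ψ v))) *
      (E.map fun a => Sym2.lift ⟨β, hsymm⟩ (a.map ψ)).prod := by
  let J := nullIdeal (condValue f p : RootedAlgebra (L ⊕ V) →ₗ[ℝ] ℝ)
  let mk : RootedAlgebra (L ⊕ V) →ₐ[ℝ] RootedAlgebra (L ⊕ V) ⧸ J := Ideal.Quotient.mkₐ ℝ J
  have hmk : ∀ {x}, x ∈ J → mk x = 0 := fun hx => Ideal.Quotient.eq_zero_iff_mem.2 hx
  let ε : V → Fin d → RootedAlgebra (L ⊕ V) := fun v i => map (Sum.map id fun _ => v) (e i)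
  have hunit : ∀ v, ∑ i, mk (ε v i) = 1 := fun v => by
    have h := hmk fun y => hp.condValue_map_mul_eq_zero hf
      (Function.injective_of_subsingleton fun _ : Unit => v) hone y
    rw [map_sub, map_sub, map_one, map_one, map_sum, map_sum, sub_eq_zero] at h
    exact h.symm
  have hedge : ∀ a b : V, a ≠ b → ∀ i j, mk (edgeElement L {s(a, b)}) * (mk (ε a i) * mk (ε b j)) =
      β i j • (mk (ε a i) * mk (ε b j)) := fun a b hab i j => by
    have hφ : Function.Injective (Sum.elim (fun _ : Unit => a) fun _ : Unit => b) := by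
      rintro (_ | _) (_ | _) h
      · rfl
      · exact absurd h hab
      · exact absurd h.symm hab
      · rfl
    have h := hmk fun y => hp.condValue_map_mul_eq_zero hf hφ (hβ i j) y
    rw [map_sub, map_sub, sub_eq_zero, map_smul, map_smul, map_mul (map _), map_mul (map _),
      map_edgeElement, map_map, map_map, Sum.map_comp_map, Sum.map_comp_map, map_mul, map_mul,
      Multiset.map_singleton] at h
    exact h
  have hprod : ∀ ψ : V → Fin d, mk (edgeElement L E) * ∏ v, mk (ε v (ψ v)) =
      (E.map fun a => Sym2.lift ⟨β, hsymm⟩ (a.map ψ)).prod • ∏ v, mk (ε v (ψ v)) := by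
    intro ψ
    induction E using Multiset.induction with
    | empty => rw [edgeElement_zero, map_one, one_mul, Multiset.map_zero, Multiset.prod_zero, one_smul]
    | cons a E ih =>
      rw [edgeElement_cons, map_mul, mul_assoc, ih fun a ha => hE a (Multiset.mem_cons_of_mem ha),
        mul_smul_comm, Multiset.map_cons, Multiset.prod_cons, mul_comm (Sym2.lift _ _), mul_smul]
      congr 1
      have ha := hE a (Multiset.mem_cons_self a E)
      induction a using Sym2.ind with
      | _ a b =>
        rw [Sym2.mk_isDiag_iff] at ha
        rw [← Finset.mul_prod_erase Finset.univ _ (Finset.mem_univ a),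
          ← Finset.mul_prod_erase (Finset.univ.erase a) _
            (Finset.mem_erase.2 ⟨Ne.symm ha, Finset.mem_univ b⟩), ← mul_assoc (mk (ε a (ψ a))),
          ← mul_assoc, hedge a b ha, smul_mul_assoc]
        rfl
  have hsum : mk (edgeElement L E) = ∑ ψ : V → Fin d,
      (E.map fun a => Sym2.lift ⟨β, hsymm⟩ (a.map ψ)).prod • ∏ v, mk (ε v (ψ v)) := by
    rw [← Finset.sum_congr rfl fun ψ _ => hprod ψ, ← Finset.mul_sum, ← Fintype.piFinset_univ,
      ← Finset.prod_univ_sum (fun _ => Finset.univ) fun v i => mk (ε v i),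
      Finset.prod_congr rfl fun v _ => hunit v, Finset.prod_const_one, mul_one]
  have hval : ∀ x, quotientFunctional (condValue f p) (mk x) = condValue f p x := fun x => rfl
  rw [← hp.condValue_edgeElement hf, ← hval, hsum, map_sum]
  refine Finset.sum_congr rfl fun ψ _ => ?_
  rw [← map_prod, map_smul, hval, hp.condValue_prod hf, smul_eq_mul, mul_comm]

end

end RootedAlgebra

open RootedAlgebra in
theorem GraphParameter.Normalizable.exists_weightedGraph {f : GraphParameter}
    (hf : f.Normalizable) {z : QuantumGraph 2} (hz : f.IsContractor z) :
    ∃ H : WeightedGraph, ∀ F : FinGraph, f F = H.hom F := by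
  classical
  obtain ⟨L, hL, p, d, e, hp, hpos, hone, hrigid⟩ := exists_rigid_state hf hz
  choose β hβ using hrigid (edgeElement L {s(Sum.inl (), Sum.inr ())})
  have hsymm := hp.edgeWeight_symm hf hpos
    fun i j => functional_mul_eq_zero (hp.nonneg _) (hβ i j)
  refine ⟨spectralGraph (fun i => condValue f p (e i)) hpos f.nodeValue hf.nodeValue_pos β hsymm,
    fun F => ?_⟩
  have h := hp.normalized_eq_sum hf hone hsymm hβ F.loopless
  have hF : f.normalized F.V F.edges = f F / f.nodeValue ^ Fintype.card F.V := by
    rw [GraphParameter.normalized, FinGraph.ofEdges_edges]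
  rw [hF, div_eq_iff (pow_ne_zero _ hf.nodeValue_pos.ne')] at h
  rw [h, Finset.sum_mul, WeightedGraph.hom]
  refine (Finset.sum_congr rfl fun ψ _ => ?_).trans (Fintype.sum_equiv (Equiv.refl _) _ _
    fun ψ => rfl)
  change _ = (∏ i, f.nodeValue * condValue f p (e (ψ i))) *
    (F.edges.map fun a => Sym2.lift ⟨β, hsymm⟩ (a.map ψ)).prod
  rw [Finset.prod_mul_distrib, Finset.prod_const, Finset.card_univ]
  ring

/-! ### Parameters vanishing on a single node -/

theorem GraphParameter.apply_edgeless_one (f : GraphParameter) :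
    f (LabeledGraph.edgeless 1).toFinGraph = f.nodeValue := by
  refine f.iso_inv _ _ ⟨(Equiv.sumEmpty (Fin 1) Empty).trans (Equiv.equivPUnit _), ?_⟩
  simp only [LabeledGraph.toFinGraph, LabeledGraph.edgeless, FinGraph.ofEdges, deleteLoops_zero,
    Multiset.map_zero]

theorem GraphParameter.eval_one_mul_one (f : GraphParameter) :
    f.eval ((1 : QuantumGraph 1) * 1) = f.nodeValue := by
  rw [mul_one, MonoidAlgebra.one_def]
  exact (f.eval_single (LabeledGraph.edgeless 1) 1).trans (by rw [one_mul, f.apply_edgeless_one])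

/-- If the value on a single node is `0`, then so is the value on every graph with a node, by the
Cauchy–Schwarz inequality. -/
theorem GraphParameter.apply_eq_zero_of_nodeValue {f : GraphParameter}
    (hrp : f.ReflectionPositive) (hc : f.nodeValue = 0) (F : FinGraph) (v : F.V) : f F = 0 := by
  classical
  let φ : F.V ≃ Fin 1 ⊕ {u // u ≠ v} := (Equiv.optionSubtypeNe v).symm.trans
    ((Equiv.optionEquivSumPUnit.{0} _).trans ((Equiv.sumComm _ _).trans
      (Equiv.sumCongr (Equiv.equivPUnit (Fin 1)).symm (Equiv.refl _))))
  let G : LabeledGraph 1 :=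
    { U := {u // u ≠ v}
      edges := F.edges.map (Sym2.map φ)
      loopless := by
        intro e he
        obtain ⟨d, hd, rfl⟩ := Multiset.mem_map.1 he
        rw [Sym2.isDiag_map φ.injective]
        exact F.loopless d hd }
  have h := functional_mul_eq_zero (hrp 1) (f.eval_one_mul_one.trans hc)
    (MonoidAlgebra.single (LabeledClass.mk G) 1)
  rw [one_mul, f.eval_single, one_mul] at h
  rw [← h]
  exact f.iso_inv _ _ ⟨φ, rfl⟩

theorem GraphParameter.exists_weightedGraph_of_nodeValue {f : GraphParameter}
    (h0 : ∃ F : FinGraph, f F ≠ 0) (hmul : f.Multiplicative) (hrp : f.ReflectionPositive)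
    (hc : f.nodeValue = 0) : ∃ H : WeightedGraph, ∀ F : FinGraph, f F = H.hom F := by
  refine ⟨{ V := Empty, α := fun i => i.elim, α_pos := fun i => i.elim, β := fun i => i.elim,
            β_symm := fun i => i.elim }, fun F => ?_⟩
  rw [WeightedGraph.hom]
  rcases isEmpty_or_nonempty F.V with hV | ⟨⟨v⟩⟩
  · have hE : F.edges = 0 := Multiset.eq_zero_of_forall_notMem fun e => by
      induction e using Sym2.ind with
      | _ a b => exact isEmptyElim a
    have h1 := apply_ofEdges_empty h0 hmul F.V
    rw [← hE, FinGraph.ofEdges_edges] at h1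
    rw [h1, hE]
    simp
  · rw [apply_eq_zero_of_nodeValue hrp hc F v]
    exact (Finset.sum_eq_zero fun ψ _ => (ψ v).elim).symm

/-! ### Homomorphism functions -/

/-- Split a sum over the maps on a disjoint union.  The instances are implicit variables, since
they are obtained from different decidable equalities in the applications. -/
theorem sum_sumArrow {A B W : Type} {_ : Fintype (A ⊕ B → W)} {_ : Fintype (A → W)}
    {_ : Fintype (B → W)} {g : (A ⊕ B → W) → ℝ} {h : (A → W) → (B → W) → ℝ}
    (hgh : ∀ ψ, g ψ = h (ψ ∘ Sum.inl) (ψ ∘ Sum.inr)) : ∑ ψ, g ψ = ∑ φ, ∑ χ, h φ χ :=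
  (Fintype.sum_equiv (Equiv.sumArrowEquivProdArrow A B W) _ (fun q => h q.1 q.2) hgh).trans
    (Fintype.sum_prod_type' h)

namespace WeightedGraph

variable (H : WeightedGraph)

open scoped Classical in
/-- The weighted number of homomorphisms of a labeled graph into `H` that extend a given map `φ` of
the labels; the nodeweights of the images of the labels are left out. -/
noncomputable def homExt {k : ℕ} (φ : Fin k → H.V) (F : LabeledGraph k) : ℝ :=
  ∑ ψ : F.U → H.V, (∏ u, H.α (ψ u)) *
    (F.edges.map fun e => H.edgeWeight (e.map (Sum.elim φ ψ))).prod

theorem homExt_iso {k : ℕ} (φ : Fin k → H.V) {F G : LabeledGraph k} (h : F.Iso G) :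
    H.homExt φ F = H.homExt φ G := by
  classical
  obtain ⟨σ, h⟩ := h
  refine Fintype.sum_equiv (Equiv.arrowCongr σ (Equiv.refl _)) _ _ fun ψ => ?_
  rw [← σ.prod_comp, ← h, Multiset.map_map]
  congr 1
  · simp
  · congr 1
    refine Multiset.map_congr rfl fun e _ => ?_
    rw [Function.comp_apply, Sym2.map_map]
    congr 2
    funext a
    obtain a | a := a <;> simp

theorem homExt_edgeless {k : ℕ} (φ : Fin k → H.V) : H.homExt φ (.edgeless k) = 1 := by
  classical
  rw [homExt, LabeledGraph.edgeless]
  simp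

theorem homExt_glue {k : ℕ} (φ : Fin k → H.V) (F G : LabeledGraph k) :
    H.homExt φ (F.glue G) = H.homExt φ F * H.homExt φ G := by
  classical
  rw [homExt, homExt, homExt, Finset.sum_mul_sum]
  refine sum_sumArrow (A := F.U) (B := G.U) fun ψ => ?_
  rw [mul_mul_mul_comm]
  congr 1
  · exact Fintype.prod_sum_type fun u => H.α (ψ u)
  · simp only [LabeledGraph.glue, Multiset.map_add, Multiset.prod_add, Multiset.map_map]
    congr 2 <;>
    · refine Multiset.map_congr rfl fun e _ => ?_
      rw [Function.comp_apply, Sym2.map_map]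
      congr 2
      funext a
      obtain a | a := a <;> rfl

theorem homExt_contract (φ : Fin 1 → H.V) (F : LabeledGraph 2) (hF : F.LabelsIndep) :
    H.homExt φ (F.contract hF) = H.homExt (fun _ => φ 0) F := by
  classical
  refine Fintype.sum_equiv (Equiv.refl _) _ _ fun ψ => ?_
  congr 2
  simp only [LabeledGraph.contract, Multiset.map_map]
  refine Multiset.map_congr rfl fun e _ => ?_
  rw [Function.comp_apply, Sym2.map_map]
  congr 2
  funext a
  obtain a | a := a <;> rfl

theorem hom_toFinGraph {k : ℕ} (F : LabeledGraph k) :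
    H.hom F.toFinGraph = ∑ φ : Fin k → H.V, (∏ i, H.α (φ i)) * H.homExt φ F := by
  classical
  simp only [homExt, Finset.mul_sum]
  refine sum_sumArrow (A := (Fin k)) (B := F.U) fun ψ => ?_
  rw [← mul_assoc]
  congr 1
  · exact Fintype.prod_sum_type fun u => H.α (ψ u)
  · congr 1
    refine Multiset.map_congr rfl fun e _ => ?_
    congr 2
    funext a
    obtain a | a := a <;> rfl

theorem hom_disjUnion (F G : FinGraph) : H.hom (F.disjUnion G) = H.hom F * H.hom G := by
  classical
  rw [hom, hom, hom, Finset.sum_mul_sum]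
  refine sum_sumArrow (A := F.V) (B := G.V) fun ψ => ?_
  rw [mul_mul_mul_comm]
  congr 1
  · exact Fintype.prod_sum_type fun u => H.α (ψ u)
  · simp only [FinGraph.disjUnion, Multiset.map_add, Multiset.prod_add, Multiset.map_map]
    congr 2 <;>
    · refine Multiset.map_congr rfl fun e _ => ?_
      rw [Function.comp_apply, Sym2.map_map]

theorem hom_empty : H.hom (FinGraph.ofEdges Empty 0) = 1 := by
  have : Unique ((FinGraph.ofEdges Empty 0).V → H.V) := inferInstanceAs (Unique (Empty → H.V))
  have : IsEmpty (FinGraph.ofEdges Empty 0).V := inferInstanceAs (IsEmpty Empty)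
  rw [hom, Fintype.sum_unique, Finset.prod_of_isEmpty, one_mul]
  simp [FinGraph.ofEdges, deleteLoops_zero]

/-- `homExt` as a homomorphism of monoids. -/
noncomputable def homExtHom {k : ℕ} (φ : Fin k → H.V) : LabeledClass k →* ℝ where
  toFun := Quotient.lift (H.homExt φ) fun _ _ h => H.homExt_iso φ h
  map_one' := H.homExt_edgeless φ
  map_mul' := by
    rintro ⟨F⟩ ⟨G⟩
    exact H.homExt_glue φ F G

/-- The linear extension of `homExt` to quantum graphs. -/
noncomputable def homExtAlg {k : ℕ} (φ : Fin k → H.V) : QuantumGraph k →ₐ[ℝ] ℝ :=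
  MonoidAlgebra.lift ℝ _ _ (H.homExtHom φ)

theorem homExtAlg_single {k : ℕ} (φ : Fin k → H.V) (F : LabeledGraph k) (r : ℝ) :
    H.homExtAlg φ (MonoidAlgebra.single (LabeledClass.mk F) r) = r * H.homExt φ F :=
  MonoidAlgebra.lift_single _ _ _

variable {H} {f : GraphParameter} (hf : ∀ F, f F = H.hom F)

include hf in
theorem eval_eq_sum_homExtAlg {k : ℕ} (x : QuantumGraph k) :
    f.eval x = ∑ φ : Fin k → H.V, (∏ i, H.α (φ i)) * H.homExtAlg φ x := by
  induction x using MonoidAlgebra.induction_linear with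
  | zero => simp
  | add x y hx hy => simp only [map_add, hx, hy, mul_add, Finset.sum_add_distrib]
  | single c r =>
    obtain ⟨F⟩ := c
    change f.eval (MonoidAlgebra.single (LabeledClass.mk F) r) =
      ∑ φ : Fin k → H.V, _ * H.homExtAlg φ (MonoidAlgebra.single (LabeledClass.mk F) r)
    rw [f.eval_single, hf, hom_toFinGraph, Finset.mul_sum]
    exact Finset.sum_congr rfl fun φ _ => by rw [homExtAlg_single, mul_left_comm]

include hf in
theorem reflectionPositive_of_eq_hom : f.ReflectionPositive := fun k x => by
  rw [eval_eq_sum_homExtAlg hf]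
  refine Finset.sum_nonneg fun φ _ => mul_nonneg (Finset.prod_nonneg fun i _ => (H.α_pos _).le) ?_
  rw [map_mul]
  exact mul_self_nonneg _

include hf in
theorem eval_contract (x : IndepQuantumGraph 2) :
    f.eval x.contract =
      ∑ i : H.V, H.α i * H.homExtAlg (fun _ => i) (IndepQuantumGraph.incl 2 x) := by
  induction x using MonoidAlgebra.induction_linear with
  | zero => simp
  | add x y hx hy => simp only [map_add, hx, hy, mul_add, Finset.sum_add_distrib]
  | single c r =>
    obtain ⟨⟨F⟩, (hF : F.LabelsIndep)⟩ := c
    have h1 : IndepQuantumGraph.incl 2 (MonoidAlgebra.single ⟨LabeledClass.mk F, hF⟩ r) =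
      MonoidAlgebra.single (LabeledClass.mk F) r := MonoidAlgebra.mapDomain_single
    have h2 : IndepQuantumGraph.contract (MonoidAlgebra.single ⟨LabeledClass.mk F, hF⟩ r) =
      MonoidAlgebra.single (LabeledClass.mk (F.contract hF)) r := MonoidAlgebra.mapDomain_single
    refine Eq.trans (congrArg f.eval h2) (Eq.trans ?_ (Finset.sum_congr rfl fun i _ =>
      congrArg (fun y => H.α i * H.homExtAlg (fun _ => i) y) h1.symm))
    rw [eval_eq_sum_homExtAlg hf]
    refine Fintype.sum_equiv (Equiv.funUnique (Fin 1) H.V) _ _ fun φ => ?_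
    rw [homExtAlg_single, homExtAlg_single, homExt_contract]
    simp

/-- A homomorphism function has a contractor: the functional `x ↦ f(x')` depends only on the
vector of the numbers `hom_φ(x)`, so it is represented by the orthogonal projection of a vector to
the space of all these vectors. -/
theorem exists_isContractor_of_eq_hom (hf : ∀ F, f F = H.hom F) :
    ∃ z : QuantumGraph 2, f.IsContractor z := by
  classical
  have hα : ∀ φ : Fin 2 → H.V, 0 ≤ ∏ i, H.α (φ i) :=
    fun φ => Finset.prod_nonneg fun i _ => (H.α_pos _).le
  let T : QuantumGraph 2 →ₗ[ℝ] EuclideanSpace ℝ (Fin 2 → H.V) :=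
    (WithLp.linearEquiv 2 ℝ ((Fin 2 → H.V) → ℝ)).symm.toLinearMap ∘ₗ
      LinearMap.pi fun φ => √(∏ i, H.α (φ i)) • (H.homExtAlg φ).toLinearMap
  have hT : ∀ x φ, T x φ = √(∏ i, H.α (φ i)) * H.homExtAlg φ x := fun x φ => rfl
  -- The vectors `T x` and `w` have inner product `∑ i, α i * hom_{ii}(x)`.
  let w : EuclideanSpace ℝ (Fin 2 → H.V) := WithLp.toLp 2 fun φ => if φ 0 = φ 1 then 1 else 0
  have hw : ∀ φ, w φ = if φ 0 = φ 1 then 1 else 0 := fun φ => rfl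
  obtain ⟨y, ⟨z, rfl⟩, y', hy', hsum⟩ := (LinearMap.range T).exists_add_mem_mem_orthogonal w
  refine ⟨z, fun x => ?_⟩
  set x' := IndepQuantumGraph.incl 2 x with hx'
  have h1 : inner ℝ (T x') (T z) = f.eval (x' * z) := by
    rw [eval_eq_sum_homExtAlg hf, PiLp.inner_apply]
    refine Finset.sum_congr rfl fun φ _ => ?_
    rw [hT, hT, map_mul]
    simp only [RCLike.inner_apply, conj_trivial]
    rw [mul_mul_mul_comm, Real.mul_self_sqrt (hα φ), mul_comm (H.homExtAlg φ z)]
  have h2 : inner ℝ (T x') w = f.eval x.contract := by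
    rw [eval_contract hf, PiLp.inner_apply, ← (finTwoArrowEquiv H.V).symm.sum_comp,
      Fintype.sum_prod_type]
    refine Finset.sum_congr rfl fun i _ => ?_
    rw [Finset.sum_eq_single i]
    · have hi : (finTwoArrowEquiv H.V).symm (i, i) = fun _ => i := by
        funext k
        fin_cases k <;> rfl
      rw [hi, hT, hw]
      simp only [RCLike.inner_apply, conj_trivial]
      rw [Fin.prod_univ_two, Real.sqrt_mul_self (H.α_pos i).le, if_pos trivial, one_mul]
    · intro j _ hj
      rw [hw]
      simp [Ne.symm hj]
    · intro h
      exact absurd (Finset.mem_univ i) h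
  rw [← h1, ← h2, hsum, inner_add_right, hy' (T x') (LinearMap.mem_range_self T x'), add_zero]

end WeightedGraph

end GraphAlg

theorem mainTheorem1 (f : GraphAlg.GraphParameter) :
    (∃ H : GraphAlg.WeightedGraph, ∀ F : GraphAlg.FinGraph, f F = H.hom F) ↔
      (∃ F : GraphAlg.FinGraph, f F ≠ 0) ∧ f.Multiplicative ∧ f.ReflectionPositive ∧
        ∃ z : GraphAlg.QuantumGraph 2, f.IsContractor z := by
  constructor
  · rintro ⟨H, hH⟩
    refine ⟨⟨GraphAlg.FinGraph.ofEdges Empty 0, ?_⟩, fun F G => ?_,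
      GraphAlg.WeightedGraph.reflectionPositive_of_eq_hom hH,
      GraphAlg.WeightedGraph.exists_isContractor_of_eq_hom hH⟩
    · rw [hH, H.hom_empty]
      exact one_ne_zero
    · rw [hH, hH, hH, H.hom_disjUnion]
  · rintro ⟨h0, hmul, hrp, z, hz⟩
    have hc : 0 ≤ f.nodeValue := by
      rw [← f.eval_one_mul_one]
      exact hrp 1 1
    rcases hc.eq_or_lt with hc | hc
    · exact GraphAlg.GraphParameter.exists_weightedGraph_of_nodeValue h0 hmul hrp hc.symm
    · exact GraphAlg.GraphParameter.Normalizable.exists_weightedGraph ⟨h0, hmul, hrp, hc⟩ hz
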